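/- Fix integers $r \ge 1$ and $p, q \ge 0$, an irreducible and aperiodic stochastic matrix $P$ on $\mathcal S=\{1,\dots,r\}$, real $p\times p$ matrices $B_1,\dots,B_r$, real $p\times q$ matrices $\Sigma_1,\dots,\Sigma_r$, and probability laws $\nu_1,\dots,\nu_r$ on $\mathbb R^q$ with mean zero and identity covariance matrix. A Markov-switching VAR(1) process with these parameters, started at time $0$, is a sequence $(X_n)_{n\ge 0}$ of random vectors in $\mathbb R^p$ with $$X_n=A_nX_{n-1}+E_n,\qquad A_n=\sum_{i=1}^r B_i\,1_{\{I_n=i\}},\qquad E_n=\sum_{i=1}^r\Sigma_i\,\varepsilon_{ni}\,1_{\{I_n=i\}}\qquad(n\ge 1),$$ where $(I_n)_{n\ge 0}$ is a Markov chain on $\mathcal S$ with transition matrix $P$ and an arbitrary initial distribution, the random vectors $\varepsilon_{ni}$ are independent over all pairs $(n,i)$ and $\varepsilon_{ni}$ has law $\nu_i$, the chain $(I_n)$ is independent of the family $(\varepsilon_{ni})$, and $X_0$ is an arbitrary random vector on the same probability space. Suppose that for some Markov chain $(J_n)_{n\ge0}$ with transition matrix $P$ (for example the stationary one) and $A_n=B_{J_n}$,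 the largest Lyapunov exponent $$\lambda=\lim_{n\to\infty}\frac1n\log\|A_nA_{n-1}\cdots A_1\|\in[-\infty,\infty)\qquad(\log 0=-\infty)$$ exists and satisfies $\lambda<0$ almost surely. Then there is exactly one probability measure $\mu$ on $\mathbb R^p$ such that every Markov-switching VAR(1) process $(X_n)$ with the given parameters converges in distribution to $\mu$ as $n\to\infty$, whatever the initial value $X_0$ and the distribution of the initial regime $I_0$. -/

import Mathlib

open MeasureTheory ProbabilityTheory Filter Topology

universe u

namespace SVAR

/-- Every state has period one: the gcd of `{n ≥ 1 : (P ^ n) i i > 0}` is `1`. -/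
def IsAperiodic {r : ℕ} (P : Matrix (Fin r) (Fin r) ℝ) : Prop :=
  ∀ (i : Fin r) (d : ℕ), (∀ n : ℕ, 1 ≤ n → 0 < (P ^ n) i i → d ∣ n) → d = 1

/-- `I 0, I 1, …` is a time-homogeneous Markov chain on `{0, …, r - 1}` with one-step transition
matrix `P` and arbitrary initial distribution, under the probability measure `Pr`. -/
structure IsMarkovChain {r : ℕ} (P : Matrix (Fin r) (Fin r) ℝ) {Ω : Type u} [MeasurableSpace Ω]
    (Pr : Measure Ω) (I : ℕ → Ω → Fin r) : Prop where
  measurable : ∀ n, Measurable (I n)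
  transition : ∀ (n : ℕ) (s : ℕ → Fin r),
    Pr {ω | ∀ k ≤ n + 1, I k ω = s k} =
      Pr {ω | ∀ k ≤ n, I k ω = s k} * ENNReal.ofReal (P (s n) (s (n + 1)))

/-- `ν` has a finite second moment, mean zero and identity covariance matrix. -/
structure IsStandardized {q : ℕ} (ν : Measure (EuclideanSpace ℝ (Fin q))) : Prop where
  memLp : MemLp (fun x : EuclideanSpace ℝ (Fin q) => x) 2 ν
  mean : ∀ a : Fin q, ∫ x, x a ∂ν = 0
  cov : ∀ a b : Fin q,
    covariance (fun x : EuclideanSpace ℝ (Fin q) => x a)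
      (fun x : EuclideanSpace ℝ (Fin q) => x b) ν = (1 : Matrix (Fin q) (Fin q) ℝ) a b

/-- The product `A_n A_{n-1} ⋯ A_1`, where `A_k = ∑ i, B i * 1_{I k = i} = B (I k)`. -/
def coeffProd {r p : ℕ} (B : Fin r → Matrix (Fin p) (Fin p) ℝ) {Ω : Type u}
    (I : ℕ → Ω → Fin r) : ℕ → Ω → Matrix (Fin p) (Fin p) ℝ
  | 0, _ => 1
  | n + 1, ω => B (I (n + 1) ω) * coeffProd B I n ω

/-- `(1 / n) log ‖A_n ⋯ A_1‖` for the operator norm of the Euclidean norm, with values in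
`[-∞, ∞]` and the convention `log 0 = -∞`. -/
noncomputable def logGrowth {r p : ℕ} (B : Fin r → Matrix (Fin p) (Fin p) ℝ) {Ω : Type u}
    (I : ℕ → Ω → Fin r) (n : ℕ) (ω : Ω) : EReal :=
  ENNReal.log ‖Matrix.toEuclideanCLM (n := Fin p) (𝕜 := ℝ) (coeffProd B I n ω)‖ₑ / (n : EReal)

/-- `X` is a Markov-switching VAR(1) process started at time `0`: the regimes `I` form a Markov
chain with transition matrix `P`, the noise variables `ε n i` are independent, `ε n i` has law
`ν i`, the regimes are independent of the noise, and `X n = A_n X (n - 1) + E_n` for `n ≥ 1`, where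
`A_n = B (I n)` and `E_n = S (I n) (ε n (I n))`. The initial value `X 0` is any random vector and
the initial regime `I 0` has any distribution. -/
structure IsProcess {r p q : ℕ} (P : Matrix (Fin r) (Fin r) ℝ)
    (B : Fin r → Matrix (Fin p) (Fin p) ℝ) (S : Fin r → Matrix (Fin p) (Fin q) ℝ)
    (ν : Fin r → Measure (EuclideanSpace ℝ (Fin q)))
    {Ω : Type u} [MeasurableSpace Ω] (Pr : Measure Ω) (I : ℕ → Ω → Fin r)
    (ε : ℕ → Fin r → Ω → EuclideanSpace ℝ (Fin q))
    (X : ℕ → Ω → EuclideanSpace ℝ (Fin p)) : Prop where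
  chain : IsMarkovChain P Pr I
  measurable_noise : ∀ n i, Measurable (ε n i)
  law_noise : ∀ n i, Pr.map (ε n i) = ν i
  indep_noise : iIndepFun (fun (k : ℕ × Fin r) => ε k.1 k.2) Pr
  indep_chain_noise :
    IndepFun (fun ω (n : ℕ) => I n ω) (fun ω (k : ℕ × Fin r) => ε k.1 k.2 ω) Pr
  measurable_init : Measurable (X 0)
  recursion : ∀ n ω, X (n + 1) ω =
    Matrix.toEuclideanLin (B (I (n + 1) ω)) (X n ω) +
      Matrix.toEuclideanLin (S (I (n + 1) ω)) (ε (n + 1) (I (n + 1) ω) ω)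

end SVAR

/-! Write `C n` for the product `A_n ⋯ A_1`. Unrolling the recursion gives `X n = C n (X 0) + Y n`,
where `Y` is driven by the same regimes and noise but starts at `0`. It is enough to show that `C n`
tends to zero almost surely for every initial regime, and that `Y n` has a limit law not depending
on the law of `I 0`.

Both follow from one quantitative consequence of the negative exponent: for some `0 < s ≤ 1` the
moments of `‖C n‖ ^ s`, for every initial state, are bounded by a summable sequence `a n`. Dominated
convergence, on the event that the given chain starts at some state charged by its initial law,
makes the truncated expected log-norm from that state decrease linearly in `n`. Mixing of the
regimes spreads this to every state, so at some time `N` all these expectations are negative. They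
are the derivatives at `s = 0` of the truncated `s`-th moments, which equal `1` there, so for small
`s` all `s`-th moments at time `N` are below `1`; submultiplicativity then gives summability
(`exists_summable_moment`).

Summability of `a n` yields `C n → 0` almost surely. For `Y`, let `b n i` be the expectation of `f
(Y n)` from regime `i`. Integrating out the first noise vector moves the starting point from `0` to
`S j e`; for an `s`-Hölder `f` the effect of this displacement after `n` more steps is at most a
constant times `a n`. Hence `b (n + 1) = P b n + O(a n)`, and a summable perturbation of a mixing
averaging iteration converges to a constant vector. The same estimate applied to `min (‖x‖ ^ s) R`
gives tightness, and Prokhorov's theorem supplies the limit law. Uniqueness only needs one process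
to exist, and one is built from the given chain on a product space. -/

namespace SVAR

/-! ### Mixing of irreducible aperiodic stochastic matrices -/

section FiniteChain

variable {r : ℕ} {P : Matrix (Fin r) (Fin r) ℝ}

/-- An irreducible aperiodic nonnegative matrix is eventually entrywise positive. -/
theorem exists_forall_pow_pos (hirr : P.IsIrreducible) (haper : IsAperiodic P) :
    ∃ N : ℕ, ∀ n ≥ N, ∀ i j, 0 < (P ^ n) i j := by
  have hnn : ∀ (n : ℕ) i j, 0 ≤ (P ^ n) i j := fun n => Matrix.pow_apply_nonneg hirr.nonneg n
  have hadd : ∀ (m n : ℕ) (i j k), 0 < (P ^ m) i j → 0 < (P ^ n) j k → 0 < (P ^ (m + n)) i k := by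
    intro m n i j k h1 h2
    rw [pow_add, Matrix.mul_apply]
    exact Finset.sum_pos' (fun l _ => mul_nonneg (hnn _ _ _) (hnn _ _ _))
      ⟨j, Finset.mem_univ _, mul_pos h1 h2⟩
  have hdiag : ∀ i, ∃ N, ∀ n ≥ N, 0 < (P ^ n) i i := by
    intro i
    set s : Set ℕ := {n | 1 ≤ n ∧ 0 < (P ^ n) i i} with hs
    have hg : Nat.setGcd s = 1 := haper i _ fun n h1 h2 => Nat.setGcd_dvd_of_mem ⟨h1, h2⟩
    -- Return times are closed under addition, and an additive monoid of naturals with gcd `1`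
    -- contains all large integers.
    obtain ⟨N, hN⟩ := Nat.exists_mem_closure_of_ge s
    refine ⟨N, fun n hn => ?_⟩
    have hmem := hN n hn (by simp [hg])
    clear hn
    induction hmem using AddSubmonoid.closure_induction with
    | mem x hx => exact hx.2
    | zero => simp
    | add x y _ _ hx hy => exact hadd _ _ _ _ _ hx hy
  choose K hK using hdiag
  choose k _ hk using (Matrix.isIrreducible_iff_exists_pow_pos hirr.nonneg).1 hirr
  -- A path of length `n` from `i` to `j`: loop at `i` for `n - k i j ≥ K i` steps, then travel in
  -- `k i j` steps.
  refine ⟨∑ i, K i + ∑ i, ∑ j, k i j, fun n hn i j => ?_⟩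
  have h1 : K i ≤ ∑ i, K i := Finset.single_le_sum (fun _ _ => Nat.zero_le _) (Finset.mem_univ i)
  have h2 : k i j ≤ ∑ j, k i j :=
    Finset.single_le_sum (fun _ _ => Nat.zero_le _) (Finset.mem_univ j)
  have h3 : ∑ j, k i j ≤ ∑ i, ∑ j, k i j :=
    Finset.single_le_sum (f := fun i => ∑ j, k i j) (fun _ _ => Nat.zero_le _) (Finset.mem_univ i)
  have := hadd (n - k i j) (k i j) i i j (hK i _ (by omega)) (hk i j)
  rwa [Nat.sub_add_cancel (by omega)] at this

theorem mulVec_le_of_le (hP : P ∈ Matrix.rowStochastic ℝ (Fin r)) {v : Fin r → ℝ} {c : ℝ}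
    (h : ∀ i, v i ≤ c) (i : Fin r) : (P.mulVec v) i ≤ c := by
  calc (P.mulVec v) i = ∑ j, P i j * v j := rfl
    _ ≤ ∑ j, P i j * c := by
        gcongr with j
        exacts [Matrix.nonneg_of_mem_rowStochastic hP, h j]
    _ = c := by rw [← Finset.sum_mul, Matrix.sum_row_of_mem_rowStochastic hP, one_mul]

theorem le_mulVec_of_le (hP : P ∈ Matrix.rowStochastic ℝ (Fin r)) {v : Fin r → ℝ} {c : ℝ}
    (h : ∀ i, c ≤ v i) (i : Fin r) : c ≤ (P.mulVec v) i := by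
  calc c = ∑ j, P i j * c := by
        rw [← Finset.sum_mul, Matrix.sum_row_of_mem_rowStochastic hP, one_mul]
    _ ≤ ∑ j, P i j * v j := by
        gcongr with j
        exacts [Matrix.nonneg_of_mem_rowStochastic hP, h j]

/-- The row gives weight at least `δ` to the state `k`, where `v` lies `d` below the bound, so the
average gains at least `δ * d`. -/
theorem mulVec_le_of_le_of_le (hP : P ∈ Matrix.rowStochastic ℝ (Fin r)) {v : Fin r → ℝ}
    {c d δ : ℝ} (h : ∀ i, v i ≤ c) (k : Fin r) (hk : v k ≤ c - d) (hd : 0 ≤ d) {i : Fin r}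
    (hδ : δ ≤ P i k) : (P.mulVec v) i ≤ c - δ * d := by
  have h1 : P i k * d ≤ ∑ j, P i j * (c - v j) :=
    (mul_le_mul_of_nonneg_left (by linarith) (Matrix.nonneg_of_mem_rowStochastic hP)).trans
      (Finset.single_le_sum (f := fun j => P i j * (c - v j)) (fun j _ => mul_nonneg
        (Matrix.nonneg_of_mem_rowStochastic hP) (by linarith [h j])) (Finset.mem_univ k))
  have h2 : ∑ j, P i j * (c - v j) = c - (P.mulVec v) i := by
    simp only [mul_sub, Finset.sum_sub_distrib, ← Finset.sum_mul,
      Matrix.sum_row_of_mem_rowStochastic hP, one_mul]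
    rfl
  have h3 : δ * d ≤ P i k * d := mul_le_mul_of_nonneg_right hδ hd
  linarith

/-- A stochastic matrix with entries at least `δ` contracts the oscillation by `1 - δ`. -/
theorem mulVec_sub_mulVec_le (hP : P ∈ Matrix.rowStochastic ℝ (Fin r)) {δ : ℝ}
    (hδ : ∀ i j, δ ≤ P i j) (hδ1 : δ ≤ 1) {v : Fin r → ℝ} {D : ℝ} (hv : ∀ i j, v i - v j ≤ D)
    (i j : Fin r) : (P.mulVec v) i - (P.mulVec v) j ≤ (1 - δ) * D := by
  have : Nonempty (Fin r) := ⟨i⟩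
  obtain ⟨k, hk⟩ := Finite.exists_min v
  obtain ⟨l, hl⟩ := Finite.exists_max v
  have h1 := mulVec_le_of_le_of_le hP (d := v l - v k) hl k (by linarith)
    (by linarith [hl k]) (hδ i k)
  have h2 := le_mulVec_of_le hP hk j
  have h3 : (1 - δ) * (v l - v k) ≤ (1 - δ) * D :=
    mul_le_mul_of_nonneg_left (hv l k) (by linarith)
  nlinarith

theorem exists_pow_apply_ge (h : ∀ i j, 0 < P i j) :
    ∃ δ > 0, δ ≤ 1 ∧ ∀ i j, δ ≤ P i j := by
  rcases isEmpty_or_nonempty (Fin r × Fin r) with he | he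
  · exact ⟨1, one_pos, le_rfl, fun i j => (he.false (i, j)).elim⟩
  · obtain ⟨k, hk⟩ := Finite.exists_min fun x : Fin r × Fin r => P x.1 x.2
    exact ⟨min (P k.1 k.2) 1, lt_min (h _ _) one_pos, min_le_right _ _,
      fun i j => (min_le_left _ _).trans (hk (i, j))⟩

/-- The oscillation of `P ^ m v` tends to zero. -/
theorem exists_forall_pow_mulVec_sub_le (hP : P ∈ Matrix.rowStochastic ℝ (Fin r))
    (hirr : P.IsIrreducible) (haper : IsAperiodic P) (v : Fin r → ℝ) {ε : ℝ} (hε : 0 < ε) :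
    ∃ M : ℕ, ∀ m ≥ M, ∀ i j, ((P ^ m).mulVec v) i - ((P ^ m).mulVec v) j ≤ ε := by
  obtain ⟨N, hN⟩ := exists_forall_pow_pos hirr haper
  obtain ⟨δ, hδ0, hδ1, hδ⟩ := exists_pow_apply_ge (hN N le_rfl)
  have hPm : ∀ m : ℕ, P ^ m ∈ Matrix.rowStochastic ℝ (Fin r) := fun m => pow_mem hP m
  obtain ⟨D, hD⟩ : ∃ D, ∀ i j, v i - v j ≤ D :=
    ⟨∑ i, |v i| + ∑ i, |v i|, fun i j => by
      have h1 : |v i| ≤ ∑ i, |v i| :=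
        Finset.single_le_sum (f := fun i => |v i|) (fun _ _ => abs_nonneg _) (Finset.mem_univ i)
      have h2 : |v j| ≤ ∑ i, |v i| :=
        Finset.single_le_sum (f := fun i => |v i|) (fun _ _ => abs_nonneg _) (Finset.mem_univ j)
      linarith [le_abs_self (v i), neg_abs_le (v j)]⟩
  have key : ∀ k : ℕ, ∀ m ≥ k * N, ∀ i j,
      ((P ^ m).mulVec v) i - ((P ^ m).mulVec v) j ≤ (1 - δ) ^ k * D := by
    intro k
    induction k with
    | zero =>
      intro m _ i j
      rw [pow_zero, one_mul]
      have : Nonempty (Fin r) := ⟨i⟩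
      obtain ⟨k, hk⟩ := Finite.exists_min v
      obtain ⟨l, hl⟩ := Finite.exists_max v
      linarith [mulVec_le_of_le (hPm m) hl i, le_mulVec_of_le (hPm m) hk j, hD l k]
    | succ k ih =>
      intro m hm i j
      -- Peel off one block `P ^ N`, which has all entries at least `δ`; each block costs a factor
      -- `1 - δ`.
      have hNm : N ≤ m := le_trans (by nlinarith) hm
      have e : P ^ m = P ^ N * P ^ (m - N) := by rw [← pow_add, Nat.add_sub_cancel' hNm]
      rw [e, ← Matrix.mulVec_mulVec, pow_succ', mul_assoc]
      refine mulVec_sub_mulVec_le (hPm N) hδ hδ1 (ih _ ?_) i j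
      rw [add_mul, one_mul] at hm
      omega
  have ht : Tendsto (fun k : ℕ => (1 - δ) ^ k * D) atTop (𝓝 (0 * D)) :=
    (tendsto_pow_atTop_nhds_zero_of_lt_one (by linarith) (by linarith)).mul_const D
  rw [zero_mul] at ht
  obtain ⟨k, hk⟩ := (ht.eventually_le_const hε).exists
  exact ⟨k * N, fun m hm i j => (key k m hm i j).trans hk⟩

theorem abs_mulVec_le (hP : P ∈ Matrix.rowStochastic ℝ (Fin r)) {v : Fin r → ℝ} {c : ℝ}
    (h : ∀ i, |v i| ≤ c) (i : Fin r) : |(P.mulVec v) i| ≤ c :=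
  abs_le.2 ⟨le_mulVec_of_le hP (fun i => (abs_le.1 (h i)).1) i,
    mulVec_le_of_le hP (fun i => (abs_le.1 (h i)).2) i⟩

/-- Averaging by `P` does not increase the sup norm, so the one-step errors merely add up. -/
theorem abs_sub_pow_mulVec_le (hP : P ∈ Matrix.rowStochastic ℝ (Fin r)) {b : ℕ → Fin r → ℝ}
    {e : ℕ → ℝ} (hb : ∀ n i, |b (n + 1) i - (P.mulVec (b n)) i| ≤ e n) (n m : ℕ) (i : Fin r) :
    |b (n + m) i - ((P ^ m).mulVec (b n)) i| ≤ ∑ k ∈ Finset.range m, e (n + k) := by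
  induction m generalizing i with
  | zero => simp
  | succ m ih =>
    have h1 := abs_mulVec_le hP (v := b (n + m) - (P ^ m).mulVec (b n)) (fun j => ih j) i
    rw [Matrix.mulVec_sub, Matrix.mulVec_mulVec, ← pow_succ'] at h1
    rw [Finset.sum_range_succ]
    have h2 := hb (n + m) i
    have h3 := abs_add_le (b (n + m + 1) i - (P.mulVec (b (n + m))) i)
      ((P.mulVec (b (n + m)) - (P ^ (m + 1)).mulVec (b n)) i)
    rw [Pi.sub_apply, sub_add_sub_cancel] at h3
    rw [Pi.sub_apply] at h1
    rw [← add_assoc]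
    linarith

/-- A summable perturbation of the iteration of an irreducible aperiodic stochastic matrix
converges to a constant vector. -/
theorem exists_tendsto_of_abs_sub_mulVec_le (hP : P ∈ Matrix.rowStochastic ℝ (Fin r))
    (hirr : P.IsIrreducible) (haper : IsAperiodic P) {b : ℕ → Fin r → ℝ} {e : ℕ → ℝ}
    (he : Summable e) (hb : ∀ n i, |b (n + 1) i - (P.mulVec (b n)) i| ≤ e n) :
    ∃ c : ℝ, ∀ i, Tendsto (fun n => b n i) atTop (𝓝 c) := by
  rcases isEmpty_or_nonempty (Fin r) with hr | ⟨⟨i₀⟩⟩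
  · exact ⟨0, fun i => (hr.false i).elim⟩
  have he0 : ∀ n, 0 ≤ e n := fun n => (abs_nonneg _).trans (hb n i₀)
  -- A Cauchy criterion uniform in time and state. After a time `n` beyond which the errors sum to
  -- at most `ε`, run the unperturbed iteration until its oscillation is at most `ε`; two error
  -- terms and one oscillation give `3 * ε`.
  have key : ∀ ε > 0, ∃ M, ∀ m ≥ M, ∀ m' ≥ m, ∀ i j, |b m' i - b m j| ≤ 3 * ε := by
    intro ε hε
    obtain ⟨n, hn⟩ := ((tendsto_sum_nat_add e).eventually_le_const hε).exists
    obtain ⟨M, hM⟩ := exists_forall_pow_mulVec_sub_le hP hirr haper (b n) hε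
    have htail : ∀ m i, |b (n + m) i - ((P ^ m).mulVec (b n)) i| ≤ ε := fun m i =>
      (abs_sub_pow_mulVec_le hP hb n m i).trans (le_trans (by
        simpa [add_comm] using (((summable_nat_add_iff n).2 he).sum_le_tsum (Finset.range m)
          fun k _ => he0 _)) hn)
    refine ⟨n + M, fun m hm m' hm' i j => ?_⟩
    obtain ⟨l, rfl⟩ := Nat.exists_eq_add_of_le (show n ≤ m by omega)
    obtain ⟨l', rfl⟩ := Nat.exists_eq_add_of_le hm'
    have hl : M ≤ l := by omega
    have h1 := htail (l' + l) i
    have h2 := htail l j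
    -- Subtract the constant `((P ^ l).mulVec (b n)) j`, which every power of `P` fixes, and average
    -- the small remainder.
    have h3 : |((P ^ (l' + l)).mulVec (b n)) i - ((P ^ l).mulVec (b n)) j| ≤ ε := by
      have h4 := abs_mulVec_le (pow_mem hP l')
        (v := (P ^ l).mulVec (b n) - fun _ => ((P ^ l).mulVec (b n)) j) (c := ε)
        (fun k => abs_le.2 ⟨by
          have := hM l hl j k
          simp only [Pi.sub_apply]; linarith, hM l hl k j⟩) i
      have h5 : (P ^ l').mulVec (fun _ => ((P ^ l).mulVec (b n)) j)
          = fun _ => ((P ^ l).mulVec (b n)) j := by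
        ext k
        exact le_antisymm (mulVec_le_of_le (pow_mem hP l') (fun _ => le_rfl) k)
          (le_mulVec_of_le (pow_mem hP l') (fun _ => le_rfl) k)
      rwa [Matrix.mulVec_sub, Matrix.mulVec_mulVec, ← pow_add, h5, Pi.sub_apply] at h4
    rw [show n + l + l' = n + (l' + l) by ring]
    rw [abs_le] at *
    constructor <;> linarith [h1.1, h1.2, h2.1, h2.2, h3.1, h3.2]
  have hc : CauchySeq fun n => b n i₀ := by
    refine Metric.cauchySeq_iff'.2 fun ε hε => ?_
    obtain ⟨M, hM⟩ := key (ε / 6) (by positivity)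
    refine ⟨M, fun n hn => ?_⟩
    rw [Real.dist_eq]
    linarith [hM M le_rfl n hn i₀ i₀]
  obtain ⟨c, hc⟩ := cauchySeq_tendsto_of_complete hc
  refine ⟨c, fun i => ?_⟩
  have hd : Tendsto (fun n => b n i - b n i₀) atTop (𝓝 0) := by
    refine Metric.tendsto_atTop.2 fun ε hε => ?_
    obtain ⟨M, hM⟩ := key (ε / 6) (by positivity)
    refine ⟨M, fun n hn => ?_⟩
    rw [Real.dist_eq, sub_zero]
    linarith [hM n hn n le_rfl i i₀]
  simpa using hd.add hc

/-- A subharmonic growth rate which is negative at one state is negative at all of them. -/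
theorem exists_forall_neg_of_drift (hP : P ∈ Matrix.rowStochastic ℝ (Fin r))
    (hirr : P.IsIrreducible) (haper : IsAperiodic P) {h : ℕ → Fin r → ℝ} {β ℓ : ℝ}
    (hβ : 0 ≤ β) (hℓ : 0 < ℓ) (hstep : ∀ n i, h (n + 1) i ≤ (P.mulVec (h n)) i + β)
    (hle : ∀ n i, h n i ≤ n * β) {i₀ : Fin r} (hneg : ∀ᶠ n : ℕ in atTop, h n i₀ ≤ -ℓ * n) :
    ∃ n, ∀ i, h n i < 0 := by
  obtain ⟨N₀, hN₀⟩ := exists_forall_pow_pos hirr haper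
  -- The extra `1` makes the block length positive, so that `n₁ + k * N` grows with `k`.
  set N := N₀ + 1 with hNdef
  obtain ⟨δ, hδ0, -, hδ⟩ := exists_pow_apply_ge (hN₀ N (by omega))
  obtain ⟨n₁, hn₁⟩ := eventually_atTop.1 hneg
  have hmulti : ∀ m n i, h (n + m) i ≤ ((P ^ m).mulVec (h n)) i + m * β := by
    intro m n
    induction m with
    | zero => simp
    | succ m ih =>
      intro i
      have h1 := mulVec_le_of_le hP (v := h (n + m) - (P ^ m).mulVec (h n)) (c := m * β)
        (fun j => by simp only [Pi.sub_apply]; linarith [ih j]) i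
      rw [Matrix.mulVec_sub, Matrix.mulVec_mulVec, ← pow_succ', Pi.sub_apply] at h1
      have h2 := hstep (n + m) i
      rw [← add_assoc]
      push_cast
      linarith
  -- The first entry makes the bound in `key` hold at time `n₁`, where only `h n j ≤ n * β` is
  -- available. The second ensures that the gain `δ * K`, from hitting `i₀` with probability at
  -- least `δ`, pays for the growth `N * β` over a block and for the required decrease `N * ℓ`.
  set K := max ((ℓ + β) * n₁) (N * (β + ℓ) / δ) with hK
  have hK0 : 0 ≤ K := le_max_of_le_left (by positivity)
  have hKδ : N * (β + ℓ) ≤ δ * K := by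
    have : N * (β + ℓ) / δ ≤ K := le_max_right _ _
    rw [div_le_iff₀ hδ0] at this
    linarith
  have key : ∀ k : ℕ, ∀ j, h (n₁ + k * N) j ≤ -ℓ * (n₁ + k * N : ℕ) + K := by
    intro k
    induction k with
    | zero =>
      intro j
      have h1 : (ℓ + β) * n₁ ≤ K := le_max_left _ _
      have h2 := hle n₁ j
      simp only [zero_mul, add_zero]
      linarith
    | succ k ih =>
      intro j
      have h1 := hmulti N (n₁ + k * N) j
      have h2 := mulVec_le_of_le_of_le (pow_mem hP N) (d := K) ih i₀
        (by have := hn₁ (n₁ + k * N) (by omega); linarith) hK0 (hδ j i₀)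
      rw [show n₁ + (k + 1) * N = n₁ + k * N + N by ring]
      push_cast at *
      linarith
  obtain ⟨k, hk⟩ := exists_nat_gt (K / ℓ)
  rw [div_lt_iff₀ hℓ] at hk
  refine ⟨n₁ + k * N, fun j => (key k j).trans_lt ?_⟩
  have h1 : (k : ℝ) ≤ (n₁ + k * N : ℕ) := by
    exact_mod_cast (show k ≤ n₁ + k * N by rw [hNdef]; nlinarith)
  have h2 : ℓ * k ≤ ℓ * (n₁ + k * N : ℕ) := mul_le_mul_of_nonneg_left h1 hℓ.le
  linarith

end FiniteChain

/-! ### Expectations along products of random maps, as iterated finite averages -/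

section AveragingOperator

variable {r : ℕ} {Z W : Type*}

/-- The averaging operator `F ↦ ((i, z) ↦ ∑ j, P i j * F j (a j z))` of the chain driving the
random maps `a j`. -/
noncomputable def avg (P : Matrix (Fin r) (Fin r) ℝ) (a : Fin r → Z → Z) (F : Fin r → Z → ℝ) :
    Fin r → Z → ℝ :=
  fun i z => ∑ j, P i j * F j (a j z)

variable {P : Matrix (Fin r) (Fin r) ℝ} {a : Fin r → Z → Z} {b : Fin r → W → W}

theorem avg_iterate_const_mul (c : ℝ) (F : Fin r → Z → ℝ) (n : ℕ) :
    (avg P a)^[n] (fun i z => c * F i z) = fun i z => c * ((avg P a)^[n] F) i z := by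
  induction n generalizing F with
  | zero => rfl
  | succ n ih =>
    have : avg P a (fun i z => c * F i z) = fun i z => c * avg P a F i z := by
      funext i z
      simp only [avg, Finset.mul_sum]
      exact Finset.sum_congr rfl fun j _ => by ring
    rw [Function.iterate_succ_apply, this, ih, ← Function.iterate_succ_apply]

theorem avg_iterate_add (F G : Fin r → Z → ℝ) (n : ℕ) :
    (avg P a)^[n] (fun i z => F i z + G i z) =
      fun i z => ((avg P a)^[n] F) i z + ((avg P a)^[n] G) i z := by
  induction n generalizing F G with
  | zero => rfl
  | succ n ih =>
    have : avg P a (fun i z => F i z + G i z) = fun i z => avg P a F i z + avg P a G i z := by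
      funext i z
      simp only [avg, mul_add, Finset.sum_add_distrib]
    simp only [Function.iterate_succ_apply, this, ih]

theorem avg_iterate_const (hP : P ∈ Matrix.rowStochastic ℝ (Fin r)) (c : ℝ) (n : ℕ) :
    (avg P a)^[n] (fun _ _ => c) = fun _ _ => c := by
  induction n with
  | zero => rfl
  | succ n ih =>
    rw [Function.iterate_succ_apply', ih]
    funext i z
    simp only [avg]
    rw [← Finset.sum_mul, Matrix.sum_row_of_mem_rowStochastic hP, one_mul]

/-- Comparison of the iterated averages of two systems of maps along a semiconjugacy. -/
theorem avg_iterate_le (hP : P ∈ Matrix.rowStochastic ℝ (Fin r)) (ψ : W → Z)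
    (hψ : ∀ j w, a j (ψ w) = ψ (b j w)) {F : Fin r → Z → ℝ} {G : Fin r → W → ℝ}
    (h : ∀ j w, F j (ψ w) ≤ G j w) (n : ℕ) (i : Fin r) (w : W) :
    ((avg P a)^[n] F) i (ψ w) ≤ ((avg P b)^[n] G) i w := by
  induction n generalizing i w with
  | zero => exact h i w
  | succ n ih =>
    rw [Function.iterate_succ_apply', Function.iterate_succ_apply']
    simp only [avg]
    gcongr with j
    · exact Matrix.nonneg_of_mem_rowStochastic hP
    · rw [hψ]
      exact ih j _

theorem avg_iterate_mono (hP : P ∈ Matrix.rowStochastic ℝ (Fin r)) {F G : Fin r → Z → ℝ}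
    (h : ∀ j z, F j z ≤ G j z) (n : ℕ) (i : Fin r) (z : Z) :
    ((avg P a)^[n] F) i z ≤ ((avg P a)^[n] G) i z :=
  avg_iterate_le (b := a) hP id (fun _ _ => rfl) h n i z

/-- Only finite sums are involved, so differentiation passes through the expectation without
domination. It is used for `t ^ s` at `s = 0`, with derivative `log t`. -/
theorem hasDerivAt_avg_iterate {F : ℝ → Fin r → Z → ℝ} {F' : Fin r → Z → ℝ} {x : ℝ}
    (h : ∀ j z, HasDerivAt (fun s => F s j z) (F' j z) x) (n : ℕ) (i : Fin r) (z : Z) :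
    HasDerivAt (fun s => ((avg P a)^[n] (F s)) i z) (((avg P a)^[n] F') i z) x := by
  induction n generalizing i z with
  | zero => exact h i z
  | succ n ih =>
    simp only [Function.iterate_succ_apply', avg]
    exact HasDerivAt.fun_sum fun j _ => (ih j (a j z)).const_mul (P i j)

end AveragingOperator

/-! ### The Markov property and orbits driven by the chain -/

section MarkovChain

variable {r : ℕ} {P : Matrix (Fin r) (Fin r) ℝ} {Ω : Type u} [MeasurableSpace Ω]
  {Pr : Measure Ω} {I : ℕ → Ω → Fin r}

/-- The path which is constant after time `n`. -/
def freeze {r : ℕ} (n : ℕ) (t : Fin (n + 1) → Fin r) (k : ℕ) : Fin r :=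
  t ⟨min k n, by omega⟩

theorem freeze_restrict (n : ℕ) (s : ℕ → Fin r) {k : ℕ} (hk : k ≤ n) :
    freeze n (fun k => s k) k = s k := by
  simp [freeze, min_eq_left hk]

theorem IsMarkovChain.measurable_restrict (hI : IsMarkovChain P Pr I) (n : ℕ) :
    Measurable fun ω (k : Fin (n + 1)) => I k ω :=
  measurable_pi_lambda _ fun k => hI.measurable k

/-- A function of the path up to time `n` factors through the finite set of such paths. -/
theorem IsMarkovChain.integrable_comp [IsFiniteMeasure Pr] (hI : IsMarkovChain P Pr I) (n : ℕ)
    {g : (ℕ → Fin r) → ℝ} (hg : ∀ s s', (∀ k ≤ n, s k = s' k) → g s = g s') :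
    Integrable (fun ω => g fun k => I k ω) Pr := by
  have h : (fun ω => g fun k => I k ω) =
      (fun t : Fin (n + 1) → Fin r => g (freeze n t)) ∘ fun ω (k : Fin (n + 1)) => I k ω := by
    funext ω
    exact hg _ _ fun k hk => (freeze_restrict n (fun k => I k ω) hk).symm
  rw [h]
  exact Integrable.comp_measurable (.of_finite) (hI.measurable_restrict n)

theorem IsMarkovChain.measureReal_restrict_and [IsFiniteMeasure Pr]
    (hP : P ∈ Matrix.rowStochastic ℝ (Fin r)) (hI : IsMarkovChain P Pr I) (n : ℕ)
    (t : Fin (n + 1) → Fin r) (j : Fin r) :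
    Pr.real {ω | (fun k : Fin (n + 1) => I k ω) = t ∧ I (n + 1) ω = j} =
      Pr.real {ω | (fun k : Fin (n + 1) => I k ω) = t} * P (t (Fin.last n)) j := by
  set s : ℕ → Fin r := fun k => if k ≤ n then freeze n t k else j with hs
  have h1 : ∀ ω, (∀ k ≤ n, I k ω = s k) ↔ (fun k : Fin (n + 1) => I k ω) = t := by
    intro ω
    constructor
    · intro h
      funext k
      have := h k (by omega)
      rw [this, hs]
      have hk : (k : ℕ) ≤ n := by omega
      simp [freeze, hk]
    · rintro rfl k hk
      simp [hs, hk, freeze]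
  have h2 : {ω | ∀ k ≤ n + 1, I k ω = s k} =
      {ω | (fun k : Fin (n + 1) => I k ω) = t ∧ I (n + 1) ω = j} := by
    ext ω
    simp only [Set.mem_ofPred_eq, ← h1]
    have hj : s (n + 1) = j := by simp [hs]
    constructor
    · exact fun h => ⟨fun k hk => h k (by omega), by rw [h _ le_rfl, hj]⟩
    · rintro ⟨h, h'⟩ k hk
      rcases Nat.lt_or_ge k (n + 1) with h3 | h3
      · exact h k (by omega)
      · obtain rfl : k = n + 1 := by omega
        rw [h', hj]
  have h3 := hI.transition n s
  rw [h2] at h3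
  simp only [h1] at h3
  have h4 : s n = t (Fin.last n) := by simp [hs, freeze, Fin.last]
  have h5 : s (n + 1) = j := by simp [hs]
  rw [Measure.real, h3, ENNReal.toReal_mul, h4, h5,
    ENNReal.toReal_ofReal (Matrix.nonneg_of_mem_rowStochastic hP), Measure.real]

/-- The Markov property, for functions of the path up to time `n` and the state at time
`n + 1`. -/
theorem IsMarkovChain.integral_succ [IsFiniteMeasure Pr]
    (hP : P ∈ Matrix.rowStochastic ℝ (Fin r)) (hI : IsMarkovChain P Pr I) (n : ℕ)
    {g : (ℕ → Fin r) → Fin r → ℝ}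
    (hg : ∀ s s', (∀ k ≤ n, s k = s' k) → g s = g s') :
    ∫ ω, g (fun k => I k ω) (I (n + 1) ω) ∂Pr =
      ∫ ω, ∑ j, P (I n ω) j * g (fun k => I k ω) j ∂Pr := by
  classical
  have hm : ∀ t : Fin (n + 1) → Fin r,
      MeasurableSet {ω | (fun k : Fin (n + 1) => I k ω) = t} := fun t =>
    hI.measurable_restrict n (measurableSet_singleton t)
  have hm' : ∀ (t : Fin (n + 1) → Fin r) (j : Fin r),
      MeasurableSet {ω | (fun k : Fin (n + 1) => I k ω) = t ∧ I (n + 1) ω = j} := fun t j =>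
    (hm t).inter (hI.measurable (n + 1) (measurableSet_singleton j))
  have hfreeze : ∀ ω, g (fun k => I k ω) = g (freeze n fun k => I k ω) := fun ω =>
    hg _ _ fun k hk => (freeze_restrict n (fun k => I k ω) hk).symm
  -- Both integrands are expanded over the finitely many paths `t` up to time `n` and next states
  -- `j`; the integrals then agree term by term.
  have hL : ∀ ω, g (fun k => I k ω) (I (n + 1) ω) = ∑ t : Fin (n + 1) → Fin r, ∑ j,
      {ω | (fun k : Fin (n + 1) => I k ω) = t ∧ I (n + 1) ω = j}.indicator
        (fun _ => g (freeze n t) j) ω := by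
    intro ω
    simp only [Set.indicator_apply, Set.mem_ofPred_eq, ite_and]
    rw [Finset.sum_eq_single (fun k : Fin (n + 1) => I k ω)]
    · simp [hfreeze ω]
    · intro t _ ht
      simp [Ne.symm ht]
    · simp
  have hR : ∀ ω, ∑ j, P (I n ω) j * g (fun k => I k ω) j = ∑ t : Fin (n + 1) → Fin r, ∑ j,
      {ω | (fun k : Fin (n + 1) => I k ω) = t}.indicator
        (fun _ => P (t (Fin.last n)) j * g (freeze n t) j) ω := by
    intro ω
    simp only [Set.indicator_apply, Set.mem_ofPred_eq]
    rw [Finset.sum_eq_single (fun k : Fin (n + 1) => I k ω)]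
    · simp [hfreeze ω]
    · intro t _ ht
      simp [Ne.symm ht]
    · simp
  simp_rw [hL, hR]
  rw [integral_finsetSum _ fun t _ => integrable_finsetSum _ fun j _ =>
      (integrable_const _).indicator (hm' t j),
    integral_finsetSum _ fun t _ => integrable_finsetSum _ fun j _ =>
      (integrable_const _).indicator (hm t)]
  refine Finset.sum_congr rfl fun t _ => ?_
  rw [integral_finsetSum _ fun j _ => (integrable_const _).indicator (hm' t j),
    integral_finsetSum _ fun j _ => (integrable_const _).indicator (hm t)]
  refine Finset.sum_congr rfl fun j _ => ?_
  rw [integral_indicator_const _ (hm' t j), integral_indicator_const _ (hm t),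
    hI.measureReal_restrict_and hP n t j]
  simp only [smul_eq_mul]
  ring

/-- The orbit of `z` under the maps `a (s 1), a (s 2), …`. -/
def orbit {Z : Type*} (a : Fin r → Z → Z) (s : ℕ → Fin r) (z : Z) : ℕ → Z
  | 0 => z
  | n + 1 => a (s (n + 1)) (orbit a s z n)

theorem orbit_congr {Z : Type*} (a : Fin r → Z → Z) {s s' : ℕ → Fin r} (z : Z) {n : ℕ}
    (h : ∀ k ≤ n, s k = s' k) : orbit a s z n = orbit a s' z n := by
  induction n with
  | zero => rfl
  | succ n ih => rw [orbit, orbit, h _ le_rfl, ih fun k hk => h k (by omega)]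

/-- The expectation of a function of the chain and of the orbit it drives. -/
theorem IsMarkovChain.integral_orbit [IsFiniteMeasure Pr]
    (hP : P ∈ Matrix.rowStochastic ℝ (Fin r)) (hI : IsMarkovChain P Pr I) {Z : Type*}
    (a : Fin r → Z → Z) (z : Z) (φ : Fin r → ℝ) (F : Fin r → Z → ℝ) (n : ℕ) :
    ∫ ω, φ (I 0 ω) * F (I n ω) (orbit a (fun k => I k ω) z n) ∂Pr =
      ∫ ω, φ (I 0 ω) * ((avg P a)^[n] F) (I 0 ω) z ∂Pr := by
  induction n generalizing F with
  | zero => rfl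
  | succ n ih =>
    rw [Function.iterate_succ_apply, ← ih]
    -- The last transition is averaged out first, replacing `F` by `avg P a F`; the factor in `I 0`
    -- belongs to the past.
    have h := hI.integral_succ hP n
      (g := fun s j => φ (s 0) * F j (a j (orbit a s z n))) (fun s s' h => by
        simp only [h 0 (Nat.zero_le _), orbit_congr a z h])
    simp only [orbit]
    rw [h]
    refine integral_congr_ae (.of_forall fun ω => ?_)
    simp only [avg, Finset.mul_sum]
    exact Finset.sum_congr rfl fun j _ => by ring

theorem IsMarkovChain.setIntegral_orbit [IsFiniteMeasure Pr]
    (hP : P ∈ Matrix.rowStochastic ℝ (Fin r)) (hI : IsMarkovChain P Pr I) {Z : Type*}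
    (a : Fin r → Z → Z) (z : Z) (i : Fin r) (F : Fin r → Z → ℝ) (n : ℕ) :
    ∫ ω in {ω | I 0 ω = i}, F (I n ω) (orbit a (fun k => I k ω) z n) ∂Pr =
      Pr.real {ω | I 0 ω = i} * ((avg P a)^[n] F) i z := by
  have hm : MeasurableSet {ω | I 0 ω = i} := hI.measurable 0 (measurableSet_singleton i)
  have h := hI.integral_orbit hP a z (fun j => if j = i then 1 else 0) F n
  rw [← integral_indicator hm]
  calc _ = ∫ ω, (if I 0 ω = i then 1 else 0) *
        F (I n ω) (orbit a (fun k => I k ω) z n) ∂Pr := by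
        refine integral_congr_ae (.of_forall fun ω => ?_)
        by_cases h : I 0 ω = i <;> simp [h]
    _ = _ := h
    _ = ∫ ω, {ω | I 0 ω = i}.indicator (fun _ => ((avg P a)^[n] F) i z) ω ∂Pr := by
        refine integral_congr_ae (.of_forall fun ω => ?_)
        by_cases h : I 0 ω = i <;> simp [h]
    _ = _ := by rw [integral_indicator_const _ hm, smul_eq_mul]

end MarkovChain

/-! ### From a negative Lyapunov exponent to summable small moments -/

section Lyapunov

/-- Truncating the norm at `exp (-n)` is truncating the growth rate at `-1`. This keeps the
logarithm real when the product vanishes and the exponent real when it is `-∞`, without changing the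
sign of the latter. -/
theorem max_log_div_eq_toReal {c : ℝ} (hc : 0 ≤ c) {n : ℕ} (hn : 0 < n) :
    Real.log (max c (Real.exp (-n))) / n =
      (max (ENNReal.log (ENNReal.ofReal c) / (n : EReal)) (-1)).toReal := by
  have hn' : (0 : ℝ) < n := by exact_mod_cast hn
  rcases hc.eq_or_lt with rfl | hc
  · rw [max_eq_right (Real.exp_pos _).le, Real.log_exp, ENNReal.ofReal_zero, ENNReal.log_zero,
      EReal.bot_div_of_pos_ne_top (by exact_mod_cast hn) (EReal.natCast_ne_top n), max_eq_right bot_le]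
    rw [neg_div, div_self hn'.ne']
    simp
  · have h1 : ENNReal.log (ENNReal.ofReal c) = ((Real.log c : ℝ) : EReal) :=
      ENNReal.log_ofReal_of_pos hc
    have h2 : ((Real.log c : ℝ) : EReal) / (n : EReal) = ((Real.log c / n : ℝ) : EReal) := by
      rw [EReal.coe_div]; rfl
    have h3 : Real.log (max c (Real.exp (-n))) = max (Real.log c) (-n) := by
      rw [Real.strictMonoOn_log.monotoneOn.map_max hc (Real.exp_pos _), Real.log_exp]
    rw [h1, h2, h3, show (-1 : EReal) = ((-1 : ℝ) : EReal) by simp, ← EReal.coe_strictMono.monotone.map_max,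
      EReal.toReal_coe, ← max_div_div_right hn'.le, neg_div, div_self hn'.ne']

variable {r : ℕ} {P : Matrix (Fin r) (Fin r) ℝ} {E : Type*} [NormedAddCommGroup E]
  [NormedSpace ℝ E]

theorem norm_orbit_le {A : Fin r → E →L[ℝ] E} {β : ℝ} (hA : ∀ j, ‖A j‖ ≤ Real.exp β)
    (s : ℕ → Fin r) (n : ℕ) : ‖orbit (fun j D => A j * D) s 1 n‖ ≤ Real.exp (n * β) := by
  induction n with
  | zero => exact (ContinuousLinearMap.norm_id_le (𝕜 := ℝ) (E := E)).trans (by simp)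
  | succ n ih =>
    rw [orbit]
    refine (norm_mul_le _ _).trans ((mul_le_mul (hA _) ih (norm_nonneg _)
      (Real.exp_pos _).le).trans_eq ?_)
    rw [← Real.exp_add]
    push_cast
    ring_nf

theorem avg_iterate_log_le (hP : P ∈ Matrix.rowStochastic ℝ (Fin r)) {A : Fin r → E →L[ℝ] E}
    {β : ℝ} (hβ : 0 ≤ β) (hA : ∀ j, ‖A j‖ ≤ Real.exp β) (c : ℝ) (hc : c ≤ 0) (n : ℕ) (i : Fin r)
    (D : E →L[ℝ] E) (hD : ‖D‖ ≤ 1) :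
    ((avg P fun j D => A j * D)^[n] fun _ D => Real.log (max ‖D‖ (Real.exp c))) i D ≤ n * β := by
  -- The bound on the initial matrix must be free, since each step multiplies that matrix by some `A
  -- j`.
  have key : ∀ (n : ℕ) (b : ℝ) (i : Fin r) (D : E →L[ℝ] E), 0 ≤ b → ‖D‖ ≤ Real.exp b →
      ((avg P fun j D => A j * D)^[n] fun _ D => Real.log (max ‖D‖ (Real.exp c))) i D
        ≤ n * β + b := by
    intro n
    induction n with
    | zero =>
      intro b i D hb hD
      simp only [Function.iterate_zero, id, CharP.cast_eq_zero, zero_mul, zero_add]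
      rw [Real.log_le_iff_le_exp (lt_max_of_lt_right (Real.exp_pos _))]
      exact max_le hD (Real.exp_le_exp.2 (hc.trans hb))
    | succ n ih =>
      intro b i D hb hD
      rw [Function.iterate_succ_apply']
      have h : ∀ j, ((avg P fun j D => A j * D)^[n] fun _ D => Real.log (max ‖D‖ (Real.exp c))) j
          (A j * D) ≤ n * β + (β + b) := fun j => ih (β + b) j _ (by positivity)
        ((norm_mul_le _ _).trans ((mul_le_mul (hA j) hD (norm_nonneg _)
          (Real.exp_pos _).le).trans_eq (Real.exp_add _ _).symm))
      refine (mulVec_le_of_le hP h i).trans_eq ?_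
      push_cast
      ring
  simpa using key n 0 i D le_rfl (by simpa using hD)

theorem eventually_lt_of_hasDerivAt_neg {f : ℝ → ℝ} {f' x : ℝ} (h : HasDerivAt f f' x)
    (hf' : f' < 0) : ∀ᶠ y in 𝓝[>] x, f y < f x := by
  have h1 := (hasDerivAt_iff_tendsto_slope.1 h).eventually_lt_const hf'
  have h2 : 𝓝[>] x ≤ 𝓝[≠] x := nhdsWithin_mono _ fun y (hy : x < y) => hy.ne'
  filter_upwards [h2 h1, self_mem_nhdsWithin] with y hy hxy
  rw [slope_def_field, div_lt_iff₀ (sub_pos.2 hxy), zero_mul] at hy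
  linarith

/-- A partial sum is at most the first `N` terms plus `γ` times itself, which bounds it as `γ < 1`.
-/
theorem summable_of_add_le_mul {a : ℕ → ℝ} (ha : ∀ n, 0 ≤ a n) {N : ℕ} {γ : ℝ} (hγ : γ < 1)
    (h : ∀ n, a (n + N) ≤ γ * a n) : Summable a := by
  refine summable_of_sum_range_le (c := (∑ k ∈ Finset.range N, a k) / (1 - γ)) ha fun n => ?_
  rw [le_div_iff₀ (by linarith)]
  have h1 : ∑ k ∈ Finset.range n, a k ≤ ∑ k ∈ Finset.range (N + n), a k :=
    Finset.sum_le_sum_of_subset_of_nonneg (Finset.range_mono (by omega)) fun _ _ _ => ha _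
  rw [Finset.sum_range_add] at h1
  have h2 : ∑ k ∈ Finset.range n, a (N + k) ≤ γ * ∑ k ∈ Finset.range n, a k := by
    rw [Finset.mul_sum]
    exact Finset.sum_le_sum fun k _ => by rw [add_comm]; exact h k
  linarith

/-- If the expected logarithm of the norm of the product is negative at some time for all initial
states, then small moments of the norms are summable. -/
theorem exists_summable_moment_of_log_neg (hP : P ∈ Matrix.rowStochastic ℝ (Fin r))
    {A : Fin r → E →L[ℝ] E} {N : ℕ} {c : ℝ}
    (hN : ∀ i, ((avg P fun j D => A j * D)^[N]
      fun _ D => Real.log (max ‖D‖ (Real.exp c))) i 1 < 0) :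
    ∃ s : ℝ, 0 < s ∧ s ≤ 1 ∧ ∃ a : ℕ → ℝ, (∀ n, 0 ≤ a n) ∧ Summable a ∧
      (∀ n i, ((avg P fun j D => A j * D)^[n] fun _ D => ‖D‖ ^ s) i 1 ≤ a n) ∧
      ∀ n i x, ((avg P fun j x => A j x)^[n] fun _ x => ‖x‖ ^ s) i x ≤ a n * ‖x‖ ^ s := by
  have hs : ∀ᶠ s in 𝓝[>] (0 : ℝ), ∀ i, ((avg P fun j D => A j * D)^[N]
      fun _ D => max ‖D‖ (Real.exp c) ^ s) i 1 < 1 := by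
    rw [eventually_all]
    intro i
    -- At `s = 0` the truncated moment is `1` and its derivative is the negative quantity in `hN`.
    -- The truncation keeps the base positive, hence the power differentiable.
    have hd := hasDerivAt_avg_iterate (P := P) (a := fun j (D : E →L[ℝ] E) => A j * D)
      (F := fun s _ D => max ‖D‖ (Real.exp c) ^ s)
      (F' := fun _ D => Real.log (max ‖D‖ (Real.exp c))) (x := 0) (fun j D => by
        have hpos : 0 < max ‖D‖ (Real.exp c) := lt_max_of_lt_right (Real.exp_pos _)
        simpa using (hasDerivAt_id (0 : ℝ)).const_rpow hpos) N i 1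
    have h1 : ((avg P fun j (D : E →L[ℝ] E) => A j * D)^[N]
        fun _ D => max ‖D‖ (Real.exp c) ^ (0 : ℝ)) i 1 = 1 := by
      simp only [Real.rpow_zero]
      rw [avg_iterate_const hP]
    have := eventually_lt_of_hasDerivAt_neg hd (hN i)
    rwa [h1] at this
  obtain ⟨s, hs, hs0, hs1⟩ :=
    (hs.and (Ioc_mem_nhdsGT (zero_lt_one' ℝ))).exists
  have hF0 : ∀ n i (D : E →L[ℝ] E),
      0 ≤ ((avg P fun j D => A j * D)^[n] fun _ D => ‖D‖ ^ s) i D := by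
    intro n i D
    have := avg_iterate_mono (a := fun j (D : E →L[ℝ] E) => A j * D) hP (F := fun _ _ => 0)
      (G := fun _ D => ‖D‖ ^ s) (fun _ D => by positivity) n i D
    rwa [avg_iterate_const hP] at this
  obtain ⟨γ, hγ0, hγ1, hγ⟩ : ∃ γ : ℝ, 0 ≤ γ ∧ γ < 1 ∧ ∀ i,
      ((avg P fun j (D : E →L[ℝ] E) => A j * D)^[N] fun _ D => ‖D‖ ^ s) i 1 ≤ γ := by
    rcases isEmpty_or_nonempty (Fin r) with hr | hr
    · exact ⟨0, le_rfl, one_pos, fun i => (hr.false i).elim⟩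
    obtain ⟨k, hk⟩ := Finite.exists_max fun i =>
      ((avg P fun j (D : E →L[ℝ] E) => A j * D)^[N] fun _ D => ‖D‖ ^ s) i 1
    refine ⟨_, hF0 N k 1, lt_of_le_of_lt ?_ (hs k), hk⟩
    exact avg_iterate_mono hP
      (fun j D => Real.rpow_le_rpow (norm_nonneg _) (le_max_left _ _) hs0.le) N k 1
  -- Right multiplication by `D` commutes with the left multiplications by `A j`, so the bound at
  -- the identity transfers to any initial matrix by submultiplicativity.
  have hN' : ∀ i (D : E →L[ℝ] E),
      ((avg P fun j D => A j * D)^[N] fun _ D => ‖D‖ ^ s) i D ≤ γ * ‖D‖ ^ s := by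
    intro i D
    have h := avg_iterate_le (a := fun j (D : E →L[ℝ] E) => A j * D)
      (b := fun j (D : E →L[ℝ] E) => A j * D) hP (fun D' => D' * D)
      (fun j D' => (mul_assoc _ _ _).symm) (F := fun _ D => ‖D‖ ^ s)
      (G := fun _ D' => ‖D‖ ^ s * ‖D'‖ ^ s) (fun j D' => by
        rw [mul_comm, ← Real.mul_rpow (norm_nonneg _) (norm_nonneg _)]
        exact Real.rpow_le_rpow (norm_nonneg _) (norm_mul_le _ _) hs0.le) N i 1
    rw [avg_iterate_const_mul, one_mul] at h
    refine h.trans ?_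
    rw [mul_comm]
    exact mul_le_mul_of_nonneg_left (hγ i) (Real.rpow_nonneg (norm_nonneg _) _)
  have hle : ∀ n i, ((avg P fun j (D : E →L[ℝ] E) => A j * D)^[n] fun _ D => ‖D‖ ^ s) i 1 ≤
      ∑ i, ((avg P fun j (D : E →L[ℝ] E) => A j * D)^[n] fun _ D => ‖D‖ ^ s) i 1 := fun n i =>
    Finset.single_le_sum
      (f := fun i => ((avg P fun j (D : E →L[ℝ] E) => A j * D)^[n] fun _ D => ‖D‖ ^ s) i 1)
      (fun i _ => hF0 n i 1) (Finset.mem_univ i)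
  refine ⟨s, hs0, hs1, fun n => ∑ i,
    ((avg P fun j (D : E →L[ℝ] E) => A j * D)^[n] fun _ D => ‖D‖ ^ s) i 1,
    fun n => Finset.sum_nonneg fun i _ => hF0 n i 1, ?_, hle, fun n i x => ?_⟩
  · refine summable_of_add_le_mul (fun n => Finset.sum_nonneg fun i _ => hF0 n i 1) hγ1
      (N := N) fun n => ?_
    rw [Finset.mul_sum]
    refine Finset.sum_le_sum fun i _ => ?_
    rw [Function.iterate_add_apply]
    refine (avg_iterate_mono hP hN' n i 1).trans_eq ?_
    rw [avg_iterate_const_mul]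
  · have h := avg_iterate_le (a := fun j x => A j x)
      (b := fun j (D : E →L[ℝ] E) => A j * D) hP (fun D => D x)
      (fun j D => rfl) (F := fun _ x => ‖x‖ ^ s)
      (G := fun _ D => ‖x‖ ^ s * ‖D‖ ^ s) (fun j D => by
        rw [mul_comm, ← Real.mul_rpow (norm_nonneg _) (norm_nonneg _)]
        exact Real.rpow_le_rpow (norm_nonneg _) (D.le_opNorm x) hs0.le) n i 1
    rw [avg_iterate_const_mul] at h
    refine h.trans ?_
    rw [mul_comm]
    exact mul_le_mul_of_nonneg_left (hle n i) (Real.rpow_nonneg (norm_nonneg _) _)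

theorem toEuclideanCLM_coeffProd {p : ℕ} (B : Fin r → Matrix (Fin p) (Fin p) ℝ) {Ω : Type u}
    (I : ℕ → Ω → Fin r) (n : ℕ) (ω : Ω) :
    Matrix.toEuclideanCLM (n := Fin p) (𝕜 := ℝ) (coeffProd B I n ω) =
      orbit (fun j D => Matrix.toEuclideanCLM (n := Fin p) (𝕜 := ℝ) (B j) * D)
        (fun k => I k ω) 1 n := by
  induction n with
  | zero => simp [coeffProd, orbit]
  | succ n ih => rw [coeffProd, orbit, map_mul, ih]

/-- A negative largest Lyapunov exponent gives summable small moments of the products. -/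
theorem exists_summable_moment {p : ℕ} (hP : P ∈ Matrix.rowStochastic ℝ (Fin r))
    (hirr : P.IsIrreducible) (haper : IsAperiodic P) (B : Fin r → Matrix (Fin p) (Fin p) ℝ)
    {Ω : Type u} [MeasurableSpace Ω] {Pr : Measure Ω} [IsProbabilityMeasure Pr]
    {J : ℕ → Ω → Fin r} (hJ : IsMarkovChain P Pr J) {lam : Ω → EReal}
    (hlam : ∀ᵐ ω ∂Pr, Tendsto (fun n : ℕ => logGrowth B J n ω) atTop (𝓝 (lam ω)) ∧ lam ω < 0) :
    ∃ s : ℝ, 0 < s ∧ s ≤ 1 ∧ ∃ a : ℕ → ℝ, (∀ n, 0 ≤ a n) ∧ Summable a ∧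
      (∀ n i, ((avg P fun j D => Matrix.toEuclideanCLM (n := Fin p) (𝕜 := ℝ) (B j) * D)^[n]
        fun _ D => ‖D‖ ^ s) i 1 ≤ a n) ∧
      ∀ n i x, ((avg P fun j x => Matrix.toEuclideanCLM (n := Fin p) (𝕜 := ℝ) (B j) x)^[n]
        fun _ x => ‖x‖ ^ s) i x ≤ a n * ‖x‖ ^ s := by
  set A := fun j => Matrix.toEuclideanCLM (n := Fin p) (𝕜 := ℝ) (B j) with hAdef
  obtain ⟨β, hβ, hA⟩ : ∃ β, 0 ≤ β ∧ ∀ j, ‖A j‖ ≤ Real.exp β := by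
    refine ⟨∑ j, ‖A j‖, Finset.sum_nonneg fun _ _ => norm_nonneg _, fun j => ?_⟩
    exact (Finset.single_le_sum (f := fun j => ‖A j‖) (fun _ _ => norm_nonneg _)
      (Finset.mem_univ j)).trans ((le_add_of_nonneg_right zero_le_one).trans
        (Real.add_one_le_exp _))
  set C : ℕ → Ω → EuclideanSpace ℝ (Fin p) →L[ℝ] EuclideanSpace ℝ (Fin p) :=
    fun n ω => orbit (fun j D => A j * D) (fun k => J k ω) 1 n with hC
  -- The hypothesis on the exponent gives information only about initial states that `J` charges;
  -- one such state suffices for the drift argument.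
  obtain ⟨i₀, hi₀⟩ : ∃ i, 0 < Pr.real {ω | J 0 ω = i} := by
    by_contra! h
    have h0 : ∀ i, Pr {ω | J 0 ω = i} = 0 := fun i => by
      have := le_antisymm (h i) measureReal_nonneg
      rwa [measureReal_eq_zero_iff] at this
    have h1 : (⋃ i, {ω | J 0 ω = i}) = Set.univ := by ext ω; simp
    have h2 := measure_iUnion_null h0
    rw [h1, measure_univ] at h2
    exact one_ne_zero h2
  set h : ℕ → Fin r → ℝ := fun n i => ((avg P fun j D => A j * D)^[n]
    fun _ D => Real.log (max ‖D‖ (Real.exp (-n)))) i 1 with hdef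
  set f : ℕ → Ω → ℝ := fun n ω => Real.log (max ‖C n ω‖ (Real.exp (-n))) / n with hf
  set g : Ω → ℝ := fun ω => (max (lam ω) (-1)).toReal with hg
  have neg_one_lt : (-1 : EReal) < 0 := by
    rw [show (-1 : EReal) = ((-1 : ℝ) : EReal) by simp]
    exact EReal.coe_neg'.2 (by norm_num)
  have bot_lt : ⊥ < (-1 : EReal) := by
    rw [show (-1 : EReal) = ((-1 : ℝ) : EReal) by simp]
    exact EReal.bot_lt_coe _
  have hfg : ∀ᵐ ω ∂Pr, Tendsto (fun n => f n ω) atTop (𝓝 (g ω)) := by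
    filter_upwards [hlam] with ω hω
    have h1 : max (lam ω) (-1) ≠ ⊤ := ne_of_lt ((max_lt hω.2 neg_one_lt).trans EReal.zero_lt_top)
    have h2 : max (lam ω) (-1) ≠ ⊥ := ne_of_gt (lt_max_of_lt_right bot_lt)
    refine ((EReal.tendsto_toReal h1 h2).comp (hω.1.max tendsto_const_nhds)).congr' ?_
    filter_upwards [eventually_gt_atTop 0] with n hn
    rw [hf]
    simp only [Function.comp, logGrowth]
    rw [max_log_div_eq_toReal (norm_nonneg _) hn, toEuclideanCLM_coeffProd, ofReal_norm]
  have hfm : ∀ n, Integrable (f n) Pr := fun n =>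
    hJ.integrable_comp n (g := fun s => Real.log (max ‖orbit (fun j D => A j * D) s 1 n‖
      (Real.exp (-n))) / n) fun s s' hs => by rw [orbit_congr _ _ hs]
  -- The truncated rate lies between `-1` and `β`, which provides the dominating constant.
  have hfb : ∀ n ω, |f n ω| ≤ 1 + β := by
    intro n ω
    rcases Nat.eq_zero_or_pos n with rfl | hn
    · simp only [hf, CharP.cast_eq_zero, div_zero, abs_zero]
      positivity
    have hn' : (0 : ℝ) < n := by exact_mod_cast hn
    have hpos : 0 < max ‖C n ω‖ (Real.exp (-n)) := lt_max_of_lt_right (Real.exp_pos _)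
    have h1 : -(n : ℝ) ≤ Real.log (max ‖C n ω‖ (Real.exp (-n))) := by
      rw [Real.le_log_iff_exp_le hpos]
      exact le_max_right _ _
    have h2 : Real.log (max ‖C n ω‖ (Real.exp (-n))) ≤ n * β := by
      rw [Real.log_le_iff_le_exp hpos]
      exact max_le (norm_orbit_le hA _ n) (Real.exp_le_exp.2 (by nlinarith))
    rw [abs_le]
    constructor
    · rw [le_div_iff₀ hn']
      nlinarith
    · rw [div_le_iff₀ hn']
      nlinarith
  set S : Set Ω := {ω | J 0 ω = i₀} with hS
  have hlim : Tendsto (fun n => ∫ ω in S, f n ω ∂Pr) atTop (𝓝 (∫ ω in S, g ω ∂Pr)) :=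
    tendsto_integral_of_dominated_convergence (fun _ => 1 + β)
      (fun n => (hfm n).integrableOn.aestronglyMeasurable) (integrable_const _)
      (fun n => .of_forall fun ω => hfb n ω) (ae_restrict_of_ae hfg)
  have hgneg : ∀ᵐ ω ∂Pr, g ω < 0 := by
    filter_upwards [hlam] with ω hω
    have h1 : max (lam ω) (-1) < 0 := max_lt hω.2 neg_one_lt
    exact EReal.toReal_neg h1 (ne_of_gt (lt_max_of_lt_right bot_lt))
  have hgint : IntegrableOn g S Pr := by
    refine ⟨aestronglyMeasurable_of_tendsto_ae atTop
      (fun n => (hfm n).integrableOn.aestronglyMeasurable) (ae_restrict_of_ae hfg),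
      HasFiniteIntegral.of_bounded (C := 1 + β) ?_⟩
    filter_upwards [ae_restrict_of_ae hfg] with ω hω
    exact le_of_tendsto (hω.abs) (.of_forall fun n => hfb n ω)
  have hneg : ∫ ω in S, g ω ∂Pr < 0 := by
    rw [← neg_pos, ← integral_neg, ← Pi.neg_def, integral_pos_iff_support_of_nonneg_ae
      ((ae_restrict_of_ae hgneg).mono fun ω hω => by simpa using hω.le) hgint.neg]
    have hsupp : Function.support (-g) =ᵐ[Pr.restrict S] Set.univ :=
      eventuallyEq_univ.2 ((ae_restrict_of_ae hgneg).mono fun ω hω => by simpa using hω.ne)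
    rw [measure_congr hsupp, Measure.restrict_apply_univ]
    exact (ENNReal.toReal_pos_iff.1 hi₀).1
  have hint : ∀ n, ∫ ω in S, f n ω ∂Pr = Pr.real S * h n i₀ / n := by
    intro n
    rw [hf, integral_div]
    congr 1
    exact hJ.setIntegral_orbit hP _ 1 i₀ (fun _ D => Real.log (max ‖D‖ (Real.exp (-n)))) n
  set κ := -∫ ω in S, g ω ∂Pr with hκ
  have hκ0 : 0 < κ := by rw [hκ]; linarith
  -- The integral of `f n` over `S` is `Pr.real S * h n i₀ / n` and tends to `-κ`, so it is
  -- eventually at most `-(κ / 2)`; this dictates the rate `κ / 2 / Pr.real S`.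
  obtain ⟨N, hN⟩ := exists_forall_neg_of_drift hP hirr haper (h := h) (β := β)
    (ℓ := κ / 2 / Pr.real S) hβ (by positivity) (fun n i => by
      -- Splitting off the first factor `A j` costs at most `β` in the logarithm. The truncation
      -- level moves from `exp (-n)` to `exp (-(n + 1))`, which only lowers it.
      have h1 : ∀ j, ((avg P fun j D => A j * D)^[n]
          fun _ D => Real.log (max ‖D‖ (Real.exp (-(n + 1 : ℕ))))) j (A j * 1) ≤ h n j + β := by
        intro j
        have h2 := avg_iterate_le (P := P) (a := fun j D => A j * D) (b := fun j D => A j * D) hP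
          (fun D => D * A j) (fun k D => (mul_assoc _ _ _).symm)
          (F := fun _ D => Real.log (max ‖D‖ (Real.exp (-(n + 1 : ℕ)))))
          (G := fun _ D => Real.log (max ‖D‖ (Real.exp (-n))) + β) (fun k D => by
            have hpos : 0 < max ‖D‖ (Real.exp (-n)) := lt_max_of_lt_right (Real.exp_pos _)
            rw [Real.log_le_iff_le_exp (lt_max_of_lt_right (Real.exp_pos _)), Real.exp_add,
              Real.exp_log hpos]
            refine max_le ((norm_mul_le _ _).trans (mul_le_mul (le_max_left _ _) (hA j)
              (norm_nonneg _) hpos.le)) (le_trans ?_ (mul_le_mul (le_max_right _ _)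
              (Real.one_le_exp hβ) zero_le_one hpos.le))
            rw [mul_one]
            exact Real.exp_le_exp.2 (by push_cast; linarith)) n j 1
        rw [avg_iterate_add, avg_iterate_const hP] at h2
        simpa using h2
      have h3 := mulVec_le_of_le hP (v := fun j => ((avg P fun j D => A j * D)^[n]
          fun _ D => Real.log (max ‖D‖ (Real.exp (-(n + 1 : ℕ))))) j (A j * 1) - h n j)
        (c := β) (fun j => by linarith [h1 j]) i
      have h4 : h (n + 1) i = ∑ j, P i j * ((avg P fun j D => A j * D)^[n]
          fun _ D => Real.log (max ‖D‖ (Real.exp (-(n + 1 : ℕ))))) j (A j * 1) := by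
        rw [hdef]
        simp only [Function.iterate_succ_apply']
        rfl
      have h5 : (P.mulVec fun j => ((avg P fun j D => A j * D)^[n]
          fun _ D => Real.log (max ‖D‖ (Real.exp (-(n + 1 : ℕ))))) j (A j * 1) - h n j) i =
          h (n + 1) i - (P.mulVec (h n)) i := by
        rw [h4]
        simp only [Matrix.mulVec, dotProduct, mul_sub, Finset.sum_sub_distrib]
      linarith)
    (fun n i => avg_iterate_log_le hP hβ hA _ (by simp) n i 1
      ContinuousLinearMap.norm_id_le) (i₀ := i₀) (by
      filter_upwards [hlim.eventually_le_const (show ∫ ω in S, g ω ∂Pr < -(κ / 2) by linarith),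
        eventually_gt_atTop 0] with n hn hn0
      have hn' : (0 : ℝ) < n := by exact_mod_cast hn0
      rw [hint, div_le_iff₀ hn'] at hn
      rw [← sub_nonneg]
      have h1 : 0 ≤ (-(κ / 2) * n - Pr.real S * h n i₀) / Pr.real S :=
        div_nonneg (by linarith) hi₀.le
      refine h1.trans_eq ?_
      have := hi₀.ne'
      field_simp)
  exact exists_summable_moment_of_log_neg hP hN

end Lyapunov

/-! ### Bounded measurable test functions -/

section BddMeas

variable {r : ℕ} {E : Type*} [MeasurableSpace E]

/-- Measurable functions bounded by `K`. -/
structure IsBddMeas (K : ℝ) (F : Fin r → E → ℝ) :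
    Prop where
  measurable : ∀ j, Measurable (F j)
  abs_le : ∀ j x, |F j x| ≤ K

theorem IsBddMeas.integrable {K : ℝ} {F : Fin r → E → ℝ} (hF : IsBddMeas K F) (j : Fin r)
    {Ω : Type*} [MeasurableSpace Ω] {μ : Measure Ω} [IsFiniteMeasure μ] {g : Ω → E}
    (hg : Measurable g) : Integrable (fun ω => F j (g ω)) μ :=
  .of_bound ((hF.measurable j).comp hg).aestronglyMeasurable K
    (.of_forall fun _ => hF.abs_le j _)

end BddMeas

/-! ### The transition operator on Hölder test functions -/

section Kernel

variable {r : ℕ} {P : Matrix (Fin r) (Fin r) ℝ} {E G : Type*}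
  [NormedAddCommGroup E] [NormedSpace ℝ E] [MeasurableSpace E] [BorelSpace E]
  [SecondCountableTopology E]
  [NormedAddCommGroup G] [NormedSpace ℝ G] [MeasurableSpace G] [BorelSpace G]
  [SecondCountableTopology G]
  {A : Fin r → E →L[ℝ] E} {S : Fin r → G →L[ℝ] E} {ν : Fin r → Measure G}

/-- The average of `F j (A j x + S j e)` over the noise `e` in regime `j`. -/
noncomputable def noiseAvg (A : Fin r → E →L[ℝ] E) (S : Fin r → G →L[ℝ] E)
    (ν : Fin r → Measure G) (F : Fin r → E → ℝ) (j : Fin r) (x : E) : ℝ :=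
  ∫ e, F j (A j x + S j e) ∂ν j

/-- The transition operator of the pair of the regime and the autoregressive process. -/
noncomputable def transOp (P : Matrix (Fin r) (Fin r) ℝ) (A : Fin r → E →L[ℝ] E)
    (S : Fin r → G →L[ℝ] E) (ν : Fin r → Measure G) (F : Fin r → E → ℝ) : Fin r → E → ℝ :=
  fun i x => ∑ j, P i j * noiseAvg A S ν F j x

variable [∀ j, IsProbabilityMeasure (ν j)]

theorem IsBddMeas.noiseAvg {K : ℝ} {F : Fin r → E → ℝ} (hF : IsBddMeas K F) :
    IsBddMeas K (noiseAvg A S ν F) where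
  measurable j := by
    have h : Measurable fun z : E × G => F j (A j z.1 + S j z.2) :=
      (hF.measurable j).comp (by fun_prop)
    exact (h.stronglyMeasurable.integral_prod_right (ν := ν j)).measurable
  abs_le j x := by
    have := norm_integral_le_of_norm_le_const (μ := ν j) (C := K)
      (f := fun e => F j (A j x + S j e)) (.of_forall fun e => hF.abs_le j _)
    simpa [SVAR.noiseAvg] using this

theorem IsBddMeas.transOp (hP : P ∈ Matrix.rowStochastic ℝ (Fin r)) {K : ℝ}
    {F : Fin r → E → ℝ} (hF : IsBddMeas K F) : IsBddMeas K (transOp P A S ν F) where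
  measurable _ := Finset.measurable_fun_sum _ fun j _ => (hF.noiseAvg.measurable j).const_mul _
  abs_le i x := abs_mulVec_le hP (fun j => hF.noiseAvg.abs_le j x) i

theorem IsBddMeas.transOp_iterate (hP : P ∈ Matrix.rowStochastic ℝ (Fin r)) {K : ℝ}
    {F : Fin r → E → ℝ} (hF : IsBddMeas K F) (n : ℕ) :
    IsBddMeas K ((SVAR.transOp P A S ν)^[n] F) := by
  induction n with
  | zero => exact hF
  | succ n ih =>
    rw [Function.iterate_succ_apply']
    exact ih.transOp hP

/-- The modulus of continuity is transported by the averaging operator. -/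
theorem abs_transOp_iterate_sub_le (hP : P ∈ Matrix.rowStochastic ℝ (Fin r)) {K : ℝ}
    {F u : Fin r → E → ℝ} (hF : IsBddMeas K F) (hu : ∀ j x y, |F j x - F j y| ≤ u j (x - y))
    (n : ℕ) (i : Fin r) (x y : E) :
    |((transOp P A S ν)^[n] F) i x - ((transOp P A S ν)^[n] F) i y| ≤
      ((avg P fun j x => A j x)^[n] u) i (x - y) := by
  induction n generalizing i x y with
  | zero => exact hu i x y
  | succ n ih =>
    rw [Function.iterate_succ_apply', Function.iterate_succ_apply']
    have hFn := hF.transOp_iterate (A := A) (S := S) (ν := ν) hP n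
    simp only [transOp, avg, noiseAvg]
    rw [← Finset.sum_sub_distrib]
    refine (Finset.abs_sum_le_sum_abs _ _).trans (Finset.sum_le_sum fun j _ => ?_)
    rw [← mul_sub, abs_mul, abs_of_nonneg (Matrix.nonneg_of_mem_rowStochastic hP)]
    refine mul_le_mul_of_nonneg_left ?_ (Matrix.nonneg_of_mem_rowStochastic hP)
    rw [← integral_sub (hFn.integrable j (by fun_prop)) (hFn.integrable j (by fun_prop))]
    have h := norm_integral_le_of_norm_le_const (μ := ν j)
      (C := ((avg P fun j x => A j x)^[n] u) j (A j (x - y)))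
      (f := fun e => ((transOp P A S ν)^[n] F) j (A j x + S j e) -
        ((transOp P A S ν)^[n] F) j (A j y + S j e)) (.of_forall fun e => by
          -- The two starting points are coupled through the same regime and noise, so the noise
          -- cancels in the difference.
          have := ih j (A j x + S j e) (A j y + S j e)
          rwa [add_sub_add_right_eq_sub, ← map_sub] at this)
    simpa using h

variable {s D : ℝ} {a : ℕ → ℝ}

/-- From `0`, the first step leads to `S j e` in the new regime `j`. Replacing this point by `0`
changes the expectation after `n` further steps by at most `L * a n * ‖S j e‖ ^ s`, whose mean is
controlled by `D`. -/
theorem abs_transOp_iterate_succ_sub_mulVec_le (hP : P ∈ Matrix.rowStochastic ℝ (Fin r))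
    (ha : ∀ n, 0 ≤ a n)
    (hmom : ∀ n i x, ((avg P fun j x => A j x)^[n] fun _ x => ‖x‖ ^ s) i x ≤ a n * ‖x‖ ^ s)
    (hint : ∀ j, Integrable (fun e => ‖S j e‖ ^ s) (ν j)) (hD : ∀ j, ∫ e, ‖S j e‖ ^ s ∂ν j ≤ D)
    {K L : ℝ} (hL : 0 ≤ L) {f : E → ℝ} (hf : IsBddMeas K fun _ : Fin r => f)
    (hfL : ∀ x y, |f x - f y| ≤ L * ‖x - y‖ ^ s) (n : ℕ) (i : Fin r) :
    |((transOp P A S ν)^[n + 1] fun _ => f) i 0 -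
      (P.mulVec fun j => ((transOp P A S ν)^[n] fun _ => f) j 0) i| ≤ L * a n * D := by
  have hFn := hf.transOp_iterate (A := A) (S := S) (ν := ν) hP n
  have h1 : ∀ j, |noiseAvg A S ν ((transOp P A S ν)^[n] fun _ => f) j 0 -
      ((transOp P A S ν)^[n] fun _ => f) j 0| ≤ L * a n * D := by
    intro j
    have h2 : noiseAvg A S ν ((transOp P A S ν)^[n] fun _ => f) j 0 -
        ((transOp P A S ν)^[n] fun _ => f) j 0 =
        ∫ e, (((transOp P A S ν)^[n] fun _ => f) j (S j e) -
          ((transOp P A S ν)^[n] fun _ => f) j 0) ∂ν j := by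
      rw [integral_sub (hFn.integrable j (by fun_prop)) (integrable_const _), noiseAvg]
      simp
    rw [h2]
    have h3 : ∀ e, ‖((transOp P A S ν)^[n] fun _ => f) j (S j e) -
        ((transOp P A S ν)^[n] fun _ => f) j 0‖ ≤ L * a n * ‖S j e‖ ^ s := by
      intro e
      have := abs_transOp_iterate_sub_le (A := A) (S := S) (ν := ν) hP hf
        (u := fun _ x => L * ‖x‖ ^ s) (fun _ => hfL) n j (S j e) 0
      rw [avg_iterate_const_mul, sub_zero] at this
      refine this.trans ?_
      rw [mul_assoc]
      exact mul_le_mul_of_nonneg_left (hmom n j _) hL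
    refine (norm_integral_le_of_norm_le ((hint j).const_mul _) (.of_forall h3)).trans ?_
    rw [integral_const_mul]
    exact mul_le_mul_of_nonneg_left (hD j) (mul_nonneg hL (ha n))
  have h4 := abs_mulVec_le hP h1 i
  rw [Function.iterate_succ_apply']
  convert h4 using 2
  simp only [transOp, Matrix.mulVec, dotProduct, mul_sub, Finset.sum_sub_distrib]

/-- Hölder test functions have one limiting expectation, whatever the initial regime. -/
theorem exists_tendsto_transOp_iterate (hP : P ∈ Matrix.rowStochastic ℝ (Fin r))
    (hirr : P.IsIrreducible) (haper : IsAperiodic P)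
    (ha : ∀ n, 0 ≤ a n) (hasum : Summable a)
    (hmom : ∀ n i x, ((avg P fun j x => A j x)^[n] fun _ x => ‖x‖ ^ s) i x ≤ a n * ‖x‖ ^ s)
    (hint : ∀ j, Integrable (fun e => ‖S j e‖ ^ s) (ν j)) (hD : ∀ j, ∫ e, ‖S j e‖ ^ s ∂ν j ≤ D)
    {K L : ℝ} (hL : 0 ≤ L) {f : E → ℝ} (hf : IsBddMeas K fun _ : Fin r => f)
    (hfL : ∀ x y, |f x - f y| ≤ L * ‖x - y‖ ^ s) :
    ∃ c : ℝ, ∀ i, Tendsto (fun n => ((transOp P A S ν)^[n] fun _ => f) i 0) atTop (𝓝 c) :=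
  exists_tendsto_of_abs_sub_mulVec_le hP hirr haper
    (b := fun n i => ((transOp P A S ν)^[n] fun _ => f) i 0) ((hasum.mul_left L).mul_right D)
    (abs_transOp_iterate_succ_sub_mulVec_le hP ha hmom hint hD hL hf hfL)

/-- Summing the one-step errors from `f 0 = 0` gives a bound uniform in `n` and free of `K`. Hence
truncations `min (‖x‖ ^ s) R` are controlled uniformly in `R`, as tightness requires. -/
theorem abs_transOp_iterate_zero_le (hP : P ∈ Matrix.rowStochastic ℝ (Fin r))
    (ha : ∀ n, 0 ≤ a n) (hasum : Summable a)
    (hmom : ∀ n i x, ((avg P fun j x => A j x)^[n] fun _ x => ‖x‖ ^ s) i x ≤ a n * ‖x‖ ^ s)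
    (hint : ∀ j, Integrable (fun e => ‖S j e‖ ^ s) (ν j)) (hD : ∀ j, ∫ e, ‖S j e‖ ^ s ∂ν j ≤ D)
    (hD0 : 0 ≤ D) {K L : ℝ} (hL : 0 ≤ L) {f : E → ℝ} (hf : IsBddMeas K fun _ : Fin r => f)
    (hfL : ∀ x y, |f x - f y| ≤ L * ‖x - y‖ ^ s) (hf0 : f 0 = 0) (n : ℕ) (i : Fin r) :
    |((transOp P A S ν)^[n] fun _ => f) i 0| ≤ L * D * ∑' k, a k := by
  have key : ∀ n i, |((transOp P A S ν)^[n] fun _ => f) i 0| ≤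
      L * D * ∑ k ∈ Finset.range n, a k := by
    intro n
    induction n with
    | zero => simp [hf0]
    | succ n ih =>
      intro i
      have h1 := abs_transOp_iterate_succ_sub_mulVec_le hP ha hmom hint hD hL hf hfL n i
      have h2 := abs_mulVec_le hP ih i
      rw [Finset.sum_range_succ]
      rw [abs_le] at *
      constructor <;> nlinarith [h1.1, h1.2, h2.1, h2.2]
  exact (key n i).trans (mul_le_mul_of_nonneg_left
    (hasum.sum_le_tsum _ fun k _ => ha k) (by positivity))

end Kernel

/-! ### Hölder estimates for the test functions -/

theorem rpow_norm_sub_le {E : Type*} [NormedAddCommGroup E] {s : ℝ} (hs : 0 ≤ s) (hs1 : s ≤ 1)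
    (x y : E) : |‖x‖ ^ s - ‖y‖ ^ s| ≤ ‖x - y‖ ^ s := by
  have key : ∀ x y : E, ‖x‖ ^ s ≤ ‖x - y‖ ^ s + ‖y‖ ^ s := fun x y => by
    have h : ‖x‖ ≤ ‖x - y‖ + ‖y‖ := by simpa using norm_add_le (x - y) y
    exact (Real.rpow_le_rpow (norm_nonneg _) h hs).trans
      (Real.rpow_add_le_add_rpow (norm_nonneg _) (norm_nonneg _) hs hs1)
  have h1 := key x y
  have h2 := key y x
  rw [norm_sub_rev] at h2
  rw [abs_le]
  constructor <;> linarith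

theorem abs_min_rpow_norm_sub_le {E : Type*} [NormedAddCommGroup E] {s : ℝ} (hs : 0 ≤ s)
    (hs1 : s ≤ 1) (R : ℝ) (x y : E) :
    |min (‖x‖ ^ s) R - min (‖y‖ ^ s) R| ≤ 1 * ‖x - y‖ ^ s := by
  rw [one_mul]
  exact (abs_min_sub_min_le_max _ _ _ _).trans
    (max_le (rpow_norm_sub_le hs hs1 x y) (by simp; positivity))

/-- Bounded Lipschitz functions are Hölder of every exponent at most one. -/
theorem exists_holder_of_lipschitz {E : Type*} [NormedAddCommGroup E] {f : E → ℝ} {C : ℝ}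
    (hC : ∀ x y, dist (f x) (f y) ≤ C) {L : NNReal} (hL : LipschitzWith L f) {s : ℝ}
    (hs : 0 < s) (hs1 : s ≤ 1) : ∃ M, 0 ≤ M ∧ ∀ x y, |f x - f y| ≤ M * ‖x - y‖ ^ s := by
  have hC0 : 0 ≤ C := dist_nonneg.trans (hC 0 0)
  refine ⟨L + C, by positivity, fun x y => ?_⟩
  rw [add_mul]
  have hp : 0 ≤ ‖x - y‖ ^ s := by positivity
  rcases le_total ‖x - y‖ 1 with h | h
  · have h1 := hL.dist_le_mul x y
    rw [dist_eq_norm, dist_eq_norm, Real.norm_eq_abs] at h1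
    have h2 : ‖x - y‖ ≤ ‖x - y‖ ^ s := by
      simpa using Real.rpow_le_rpow_of_exponent_ge_of_imp (norm_nonneg (x - y)) h hs1
        (fun _ h => absurd h one_ne_zero)
    have h3 := mul_le_mul_of_nonneg_left h2 L.2
    have h4 := mul_nonneg hC0 hp
    exact (h1.trans h3).trans (le_add_of_nonneg_right h4)
  · have h1 := hC x y
    rw [Real.dist_eq] at h1
    have h2 : 1 ≤ ‖x - y‖ ^ s := Real.one_le_rpow h hs.le
    have h3 := mul_nonneg L.2 hp
    have h4 := mul_le_mul_of_nonneg_left h2 hC0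
    have h5 : (0 : ℝ) ≤ L * ‖x - y‖ ^ s := h3
    linarith

/-! ### The process started at zero and its law -/

section Path

variable {r : ℕ} {E G : Type*}
  [NormedAddCommGroup E] [NormedSpace ℝ E] [NormedAddCommGroup G] [NormedSpace ℝ G]

/-- The autoregressive process started at `0`, as a function of the regimes `s` and the
noise `e`. -/
def pathProc (A : Fin r → E →L[ℝ] E) (S : Fin r → G →L[ℝ] E) (s : ℕ → Fin r)
    (e : ℕ × Fin r → G) : ℕ → E
  | 0 => 0
  | n + 1 => A (s (n + 1)) (pathProc A S s e n) + S (s (n + 1)) (e (n + 1, s (n + 1)))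

variable {A : Fin r → E →L[ℝ] E} {S : Fin r → G →L[ℝ] E}

theorem pathProc_congr {s s' : ℕ → Fin r} {e e' : ℕ × Fin r → G} {n : ℕ}
    (hs : ∀ k ≤ n, s k = s' k) (he : ∀ k ≤ n, ∀ j, e (k, j) = e' (k, j)) :
    pathProc A S s e n = pathProc A S s' e' n := by
  induction n with
  | zero => rfl
  | succ n ih =>
    rw [pathProc, pathProc, ih (fun k hk => hs k (by omega)) fun k hk => he k (by omega),
      hs _ le_rfl, he _ le_rfl]

/-- An autoregressive process is the one started at `0` plus the orbit of the initial value. -/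
theorem eq_orbit_add_pathProc {s : ℕ → Fin r} {e : ℕ × Fin r → G} {x : ℕ → E}
    (h : ∀ n, x (n + 1) = A (s (n + 1)) (x n) + S (s (n + 1)) (e (n + 1, s (n + 1)))) (n : ℕ) :
    x n = orbit (fun j D => A j * D) s 1 n (x 0) + pathProc A S s e n := by
  induction n with
  | zero => simp [orbit, pathProc]
  | succ n ih =>
    rw [h, orbit, pathProc, ← add_assoc, mul_apply_eq_comp, ← map_add, ← ih]

variable [MeasurableSpace E] [BorelSpace E] [SecondCountableTopology E]
  [MeasurableSpace G] [BorelSpace G]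

theorem measurable_pathProc (n : ℕ) :
    Measurable fun z : (ℕ → Fin r) × (ℕ × Fin r → G) => pathProc A S z.1 z.2 n := by
  induction n with
  | zero => exact measurable_const
  | succ n ih =>
    have h : Measurable fun w : Fin r × (E × (Fin r → G)) => A w.1 w.2.1 + S w.1 (w.2.2 w.1) := by
      refine measurable_from_prod_countable_right fun j => ?_
      have : Measurable fun y : E × (Fin r → G) => A j y.1 + S j (y.2 j) := by fun_prop
      exact this
    have h2 : Measurable fun z : (ℕ → Fin r) × (ℕ × Fin r → G) =>
        (z.1 (n + 1), (pathProc A S z.1 z.2 n, fun j : Fin r => z.2 (n + 1, j))) := by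
      fun_prop
    exact h.comp h2

theorem measurable_pathProc_noise (s : ℕ → Fin r) (n : ℕ) :
    Measurable fun e : ℕ × Fin r → G => pathProc A S s e n :=
  (measurable_pathProc n).comp (measurable_const.prodMk measurable_id)

theorem measurable_apply_pathProc {K : ℝ} {F : Fin r → E → ℝ} (hF : IsBddMeas K F) (n : ℕ) :
    Measurable fun z : (ℕ → Fin r) × (ℕ × Fin r → G) => F (z.1 n) (pathProc A S z.1 z.2 n) := by
  have h : Measurable fun w : Fin r × E => F w.1 w.2 :=
    measurable_from_prod_countable_right fun j => hF.measurable j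
  have h2 : Measurable fun z : (ℕ → Fin r) × (ℕ × Fin r → G) => (z.1 n, pathProc A S z.1 z.2 n) :=
    ((measurable_pi_apply n).comp measurable_fst).prodMk (measurable_pathProc n)
  exact h.comp h2

variable {ν : Fin r → Measure G} [∀ j, IsProbabilityMeasure (ν j)]

/-- For a fixed regime path, the state at time `n` uses only noise with time index at most `n`. -/
theorem indepFun_pathProc (s : ℕ → Fin r) (n : ℕ) (j : Fin r) :
    IndepFun (fun e : ℕ × Fin r → G => pathProc A S s e n) (fun e => e (n + 1, j))
      (Measure.infinitePi fun k : ℕ × Fin r => ν k.2) := by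
  classical
  have hi := iIndepFun_infinitePi (P := fun k : ℕ × Fin r => ν k.2) (X := fun _ x => x)
    fun _ => measurable_id
  have h := hi.indepFun_finset ((Finset.range (n + 1)) ×ˢ Finset.univ) {(n + 1, j)}
    (by
      rw [Finset.disjoint_singleton_right]
      simp) (fun k => measurable_pi_apply k)
  -- Filling the missing coordinates with `0` is harmless, as the state at time `n` does not read
  -- them.
  let ext : (((Finset.range (n + 1)) ×ˢ Finset.univ : Finset (ℕ × Fin r)) → G) →
    ℕ × Fin r → G := fun t k => if hk : k ∈ (Finset.range (n + 1)) ×ˢ Finset.univ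
      then t ⟨k, hk⟩ else 0
  have hext : Measurable ext := by
    refine measurable_pi_lambda _ fun k => ?_
    by_cases hk : k ∈ (Finset.range (n + 1)) ×ˢ (Finset.univ : Finset (Fin r))
    · simp only [ext, dif_pos hk]
      exact measurable_pi_apply _
    · simp only [ext, dif_neg hk]
      exact measurable_const
  have hψ : Measurable fun t : ({(n + 1, j)} : Finset (ℕ × Fin r)) → G =>
      t ⟨(n + 1, j), Finset.mem_singleton_self _⟩ := measurable_pi_apply _
  have h2 := h.comp (φ := fun t => pathProc A S s (ext t) n)
    ((measurable_pathProc_noise s n).comp hext) hψ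
  refine h2.congr (.of_forall fun e => ?_) (.of_forall fun e => rfl)
  refine pathProc_congr (fun _ _ => rfl) fun k hk i => ?_
  have hmem : (k, i) ∈ (Finset.range (n + 1)) ×ˢ (Finset.univ : Finset (Fin r)) := by
    simp; omega
  simp only [ext, dif_pos hmem]

variable [SecondCountableTopology G]

theorem integral_pathProc_succ {K : ℝ} {F : Fin r → E → ℝ} (hF : IsBddMeas K F)
    (s : ℕ → Fin r) (n : ℕ) :
    ∫ e, F (s (n + 1)) (pathProc A S s e (n + 1))
        ∂(Measure.infinitePi fun k : ℕ × Fin r => ν k.2) =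
      ∫ e, noiseAvg A S ν F (s (n + 1)) (pathProc A S s e n)
        ∂(Measure.infinitePi fun k : ℕ × Fin r => ν k.2) := by
  set j := s (n + 1) with hj
  set μ := Measure.infinitePi fun k : ℕ × Fin r => ν k.2 with hμ
  have hy := measurable_pathProc_noise (A := A) (S := S) s n
  have he : Measurable fun e : ℕ × Fin r → G => e (n + 1, j) := measurable_pi_apply _
  have hmap : μ.map (fun e => e (n + 1, j)) = ν j :=
    (measurePreserving_eval_infinitePi (fun k : ℕ × Fin r => ν k.2) (n + 1, j)).map_eq
  have hprod := (indepFun_pathProc (A := A) (S := S) (ν := ν) s n j).map_prod_eq_prod_map_map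
    hy.aemeasurable he.aemeasurable
  rw [← hμ, hmap] at hprod
  have : IsProbabilityMeasure (μ.map fun e => pathProc A S s e n) :=
    Measure.isProbabilityMeasure_map hy.aemeasurable
  have hm : Measurable fun w : E × G => F j (A j w.1 + S j w.2) :=
    (hF.measurable j).comp (by fun_prop)
  calc ∫ e, F j (pathProc A S s e (n + 1)) ∂μ
      = ∫ w, F j (A j w.1 + S j w.2)
          ∂(μ.map fun e => (pathProc A S s e n, e (n + 1, j))) := by
        rw [integral_map (hy.prodMk he).aemeasurable hm.aestronglyMeasurable]
        rfl
    _ = ∫ x, ∫ e, F j (A j x + S j e) ∂ν j ∂(μ.map fun e => pathProc A S s e n) := by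
        rw [hprod, integral_prod]
        exact hF.integrable j (by fun_prop)
    _ = _ := by
        rw [integral_map hy.aemeasurable]
        · rfl
        · exact (hF.noiseAvg.measurable j).aestronglyMeasurable

variable {P : Matrix (Fin r) (Fin r) ℝ} {Ω : Type u} [MeasurableSpace Ω] {Pr : Measure Ω}
  [IsProbabilityMeasure Pr] {I : ℕ → Ω → Fin r}

/-- Each step integrates out the last noise vector for a frozen regime path, then averages the last
regime by the Markov property; together these two operations apply `transOp` once. -/
theorem integral_integral_pathProc (hP : P ∈ Matrix.rowStochastic ℝ (Fin r))
    (hI : IsMarkovChain P Pr I) {K : ℝ} {F : Fin r → E → ℝ} (hF : IsBddMeas K F) (n : ℕ) :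
    ∫ ω, ∫ e, F (I n ω) (pathProc A S (fun k => I k ω) e n)
        ∂(Measure.infinitePi fun k : ℕ × Fin r => ν k.2) ∂Pr =
      ∫ ω, ((transOp P A S ν)^[n] F) (I 0 ω) 0 ∂Pr := by
  induction n generalizing F with
  | zero => simp [pathProc]
  | succ n ih =>
    rw [Function.iterate_succ_apply, ← ih (hF.transOp hP)]
    have h := hI.integral_succ hP n
      (g := fun s j => ∫ e, noiseAvg A S ν F j (pathProc A S s e n)
        ∂(Measure.infinitePi fun k : ℕ × Fin r => ν k.2)) (fun s s' h => by
          funext j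
          simp only [pathProc_congr (A := A) (S := S) h fun _ _ _ => rfl])
    calc _ = _ := integral_congr_ae (.of_forall fun ω =>
          integral_pathProc_succ hF (fun k => I k ω) n)
      _ = _ := h
      _ = _ := by
        refine integral_congr_ae (.of_forall fun ω => ?_)
        simp only [transOp]
        rw [integral_finsetSum _ fun j _ => (hF.noiseAvg.integrable j
          (measurable_pathProc_noise _ n)).const_mul _]
        simp only [integral_const_mul]

/-- The law of the process started at `0` is given by the iterated transition operator. -/
theorem integral_pathProc (hP : P ∈ Matrix.rowStochastic ℝ (Fin r))
    (hI : IsMarkovChain P Pr I) {ε : ℕ → Fin r → Ω → G} (hε : ∀ n i, Measurable (ε n i))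
    (hlaw : ∀ n i, Pr.map (ε n i) = ν i)
    (hindep : iIndepFun (fun (k : ℕ × Fin r) => ε k.1 k.2) Pr)
    (hIε : IndepFun (fun ω (n : ℕ) => I n ω) (fun ω (k : ℕ × Fin r) => ε k.1 k.2 ω) Pr)
    {K : ℝ} {F : Fin r → E → ℝ} (hF : IsBddMeas K F) (n : ℕ) :
    ∫ ω, F (I n ω) (pathProc A S (fun k => I k ω) (fun k => ε k.1 k.2 ω) n) ∂Pr =
      ∫ ω, ((transOp P A S ν)^[n] F) (I 0 ω) 0 ∂Pr := by
  rw [← integral_integral_pathProc (A := A) (S := S) (ν := ν) hP hI hF]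
  have hmI : Measurable fun ω (n : ℕ) => I n ω := measurable_pi_lambda _ hI.measurable
  have hmε : Measurable fun ω (k : ℕ × Fin r) => ε k.1 k.2 ω :=
    measurable_pi_lambda _ fun k => hε k.1 k.2
  have hmap : Pr.map (fun ω (k : ℕ × Fin r) => ε k.1 k.2 ω) =
      Measure.infinitePi fun k : ℕ × Fin r => ν k.2 := by
    have h := hindep.map_fun_eq_infinitePi_map fun k : ℕ × Fin r => hε k.1 k.2
    simp only [hlaw] at h
    exact h
  have hprod := hIε.map_prod_eq_prod_map_map hmI.aemeasurable hmε.aemeasurable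
  rw [hmap] at hprod
  have hm := measurable_apply_pathProc (A := A) (S := S) hF n
  have : IsProbabilityMeasure (Pr.map fun ω (n : ℕ) => I n ω) :=
    Measure.isProbabilityMeasure_map hmI.aemeasurable
  calc _ = ∫ z, F (z.1 n) (pathProc A S z.1 z.2 n)
          ∂(Pr.map fun ω => (fun n => I n ω, fun k : ℕ × Fin r => ε k.1 k.2 ω)) := by
        rw [integral_map (hmI.prodMk hmε).aemeasurable hm.aestronglyMeasurable]
    _ = ∫ s, ∫ e, F (s n) (pathProc A S s e n)
          ∂(Measure.infinitePi fun k : ℕ × Fin r => ν k.2) ∂(Pr.map fun ω n => I n ω) := by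
        rw [hprod, integral_prod]
        exact .of_bound hm.aestronglyMeasurable K (.of_forall fun z => hF.abs_le _ _)
    _ = _ := by
        rw [integral_map hmI.aemeasurable]
        exact (hm.stronglyMeasurable.integral_prod_right
          (ν := Measure.infinitePi fun k : ℕ × Fin r => ν k.2)).aestronglyMeasurable

end Path

/-! ### Almost sure decay, tightness and existence of a limit law -/

section Limit

variable {r : ℕ} {P : Matrix (Fin r) (Fin r) ℝ} {Ω : Type u} [MeasurableSpace Ω]
  {Pr : Measure Ω} {I : ℕ → Ω → Fin r}

/-- The sum of the functions has finite integral, so it converges almost everywhere and its terms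
vanish in the limit. -/
theorem ae_tendsto_zero_of_summable_integral {f : ℕ → Ω → ℝ} (hf : ∀ n, Integrable (f n) Pr)
    (hf0 : ∀ n ω, 0 ≤ f n ω) {a : ℕ → ℝ} (ha : Summable a) (hfa : ∀ n, ∫ ω, f n ω ∂Pr ≤ a n) :
    ∀ᵐ ω ∂Pr, Tendsto (fun n => f n ω) atTop (𝓝 0) := by
  have hm : ∀ n, AEMeasurable (fun ω => ENNReal.ofReal (f n ω)) Pr := fun n =>
    (hf n).aemeasurable.ennreal_ofReal
  have h1 : ∫⁻ ω, ∑' n, ENNReal.ofReal (f n ω) ∂Pr ≠ ⊤ := by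
    rw [lintegral_tsum hm]
    refine ne_top_of_le_ne_top ha.tsum_ofReal_ne_top (ENNReal.tsum_le_tsum fun n => ?_)
    rw [← ofReal_integral_eq_lintegral_ofReal (hf n) (.of_forall (hf0 n))]
    exact ENNReal.ofReal_le_ofReal (hfa n)
  filter_upwards [ae_lt_top' (AEMeasurable.tsum hm) h1] with ω hω
  have h2 := ENNReal.tendsto_atTop_zero_of_tsum_ne_top hω.ne
  have h3 := (ENNReal.tendsto_toReal ENNReal.zero_ne_top).comp h2
  simpa [Function.comp_def, ENNReal.toReal_ofReal (hf0 _ ω)] using h3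

variable [IsProbabilityMeasure Pr]

theorem IsMarkovChain.ae_tendsto_orbit {E : Type*} [NormedAddCommGroup E] [NormedSpace ℝ E]
    (hP : P ∈ Matrix.rowStochastic ℝ (Fin r)) (hI : IsMarkovChain P Pr I) {A : Fin r → E →L[ℝ] E}
    {s : ℝ} (hs : 0 < s) {a : ℕ → ℝ} (ha : Summable a)
    (h : ∀ n i, ((avg P fun j D => A j * D)^[n] fun _ D => ‖D‖ ^ s) i 1 ≤ a n) :
    ∀ᵐ ω ∂Pr, Tendsto (fun n => orbit (fun j D => A j * D) (fun k => I k ω) 1 n) atTop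
      (𝓝 0) := by
  have h1 := ae_tendsto_zero_of_summable_integral (Pr := Pr)
    (f := fun n ω => ‖orbit (fun j D => A j * D) (fun k => I k ω) 1 n‖ ^ s)
    (fun n => hI.integrable_comp n
      (g := fun t => ‖orbit (fun j D => A j * D) t 1 n‖ ^ s)
      fun t t' ht => by rw [orbit_congr _ _ ht]) (fun n ω => by positivity) ha (fun n => by
      have h2 := hI.integral_orbit hP (fun j D => A j * D) 1 (fun _ => 1) (fun _ D => ‖D‖ ^ s) n
      simp only [one_mul] at h2
      rw [h2]
      refine (integral_mono (hI.integrable_comp 0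
        (g := fun t => ((avg P fun j D => A j * D)^[n] fun _ D => ‖D‖ ^ s) (t 0) 1)
        fun t t' ht => by rw [ht 0 le_rfl]) (integrable_const (a n)) fun ω => h n _).trans_eq ?_
      simp)
  filter_upwards [h1] with ω hω
  have h3 := hω.rpow_const (p := s⁻¹) (.inr (inv_nonneg.2 hs.le))
  rw [Real.zero_rpow (inv_ne_zero hs.ne')] at h3
  rw [tendsto_zero_iff_norm_tendsto_zero]
  refine h3.congr fun n => ?_
  rw [← Real.rpow_mul (norm_nonneg _), mul_inv_cancel₀ hs.ne', Real.rpow_one]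

theorem IsMarkovChain.tendsto_integral_init (hI : IsMarkovChain P Pr I) {b : ℕ → Fin r → ℝ}
    {K c : ℝ} (hb : ∀ n i, |b n i| ≤ K) (hc : ∀ i, Tendsto (fun n => b n i) atTop (𝓝 c)) :
    Tendsto (fun n => ∫ ω, b n (I 0 ω) ∂Pr) atTop (𝓝 c) := by
  have := tendsto_integral_of_dominated_convergence (μ := Pr) (F := fun n ω => b n (I 0 ω))
    (f := fun _ => c) (fun _ => K)
    (fun n => (hI.integrable_comp 0 (g := fun t => b n (t 0))
      fun t t' ht => by rw [ht 0 le_rfl]).aestronglyMeasurable) (integrable_const _)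
    (fun n => .of_forall fun ω => hb n _) (.of_forall fun ω => hc _)
  simpa using this

variable {E : Type*} [NormedAddCommGroup E] [MeasurableSpace E] [BorelSpace E]

/-- Markov's inequality for the moment truncated at the level `ρ ^ s`. Truncated moments avoid any
prior integrability of `‖Y n‖ ^ s`. -/
theorem isTightMeasureSet_of_moment_le [ProperSpace E] {Y : ℕ → Ω → E}
    (hY : ∀ n, Measurable (Y n)) {s M : ℝ} (hs : 0 < s)
    (hM : ∀ n R, 0 ≤ R → ∫ ω, min (‖Y n ω‖ ^ s) R ∂Pr ≤ M) :
    IsTightMeasureSet (Set.range fun n => Pr.map (Y n)) := by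
  refine isTightMeasureSet_of_tendsto_measure_norm_gt ?_
  have hlim : Tendsto (fun ρ : ℝ => ENNReal.ofReal (M / ρ ^ s)) atTop (𝓝 0) := by
    rw [← ENNReal.ofReal_zero]
    exact ENNReal.tendsto_ofReal (tendsto_const_nhds.div_atTop (tendsto_rpow_atTop hs))
  refine tendsto_of_tendsto_of_tendsto_of_le_of_le' tendsto_const_nhds hlim
    (.of_forall fun _ => zero_le) ?_
  filter_upwards [eventually_gt_atTop 0] with ρ hρ
  refine iSup₂_le ?_
  rintro _ ⟨n, rfl⟩
  have hρs : 0 < ρ ^ s := by positivity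
  have hm : MeasurableSet {x : E | ρ < ‖x‖} := measurableSet_lt measurable_const measurable_norm
  rw [Measure.map_apply (hY n) hm]
  have h1 := mul_meas_ge_le_integral_of_nonneg (μ := Pr)
    (f := fun ω => min (‖Y n ω‖ ^ s) (ρ ^ s)) (.of_forall fun ω => by positivity)
    (.of_bound (((hY n).norm.pow_const s).min measurable_const).aestronglyMeasurable (ρ ^ s)
      (.of_forall fun ω => by
        rw [Real.norm_of_nonneg (by positivity)]
        exact min_le_right _ _)) (ρ ^ s)
  have h2 := h1.trans (hM n _ hρs.le)
  rw [mul_comm, ← le_div_iff₀ hρs] at h2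
  have h3 : Y n ⁻¹' {x | ρ < ‖x‖} ⊆ {ω | ρ ^ s ≤ min (‖Y n ω‖ ^ s) (ρ ^ s)} := fun ω hω =>
    le_min (Real.rpow_le_rpow hρ.le (le_of_lt hω) hs.le) le_rfl
  rw [ENNReal.le_ofReal_iff_toReal_le (measure_ne_top _ _)
    (le_trans measureReal_nonneg h2)]
  exact (measureReal_mono h3).trans h2

/-- A tight sequence of random variables whose expectations of bounded Lipschitz functions
converge has a limit law. -/
theorem exists_limit_of_tight {Y : ℕ → Ω → E}
    (hY : ∀ n, Measurable (Y n)) (htight : IsTightMeasureSet (Set.range fun n => Pr.map (Y n)))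
    (hlim : ∀ f : E → ℝ, (∃ C : ℝ, ∀ x y, dist (f x) (f y) ≤ C) → (∃ L, LipschitzWith L f) →
      ∃ c, Tendsto (fun n => ∫ ω, f (Y n ω) ∂Pr) atTop (𝓝 c)) :
    ∃ μ : ProbabilityMeasure E, ∀ f : E → ℝ, (∃ C : ℝ, ∀ x y, dist (f x) (f y) ≤ C) →
      (∃ L, LipschitzWith L f) →
      Tendsto (fun n => ∫ ω, f (Y n ω) ∂Pr) atTop (𝓝 (∫ x, f x ∂(μ : Measure E))) := by
  set m : ℕ → ProbabilityMeasure E := fun n =>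
    ⟨Pr.map (Y n), Measure.isProbabilityMeasure_map (hY n).aemeasurable⟩ with hm
  have hcomp : IsCompact (closure (Set.range m)) := by
    refine isCompact_closure_of_isTightMeasureSet (htight.subset ?_)
    rintro _ ⟨_, ⟨n, rfl⟩, rfl⟩
    exact ⟨n, rfl⟩
  -- A cluster point is enough: each test integral already converges, and its limit must agree with
  -- its value at the cluster point.
  obtain ⟨μ, -, hμ⟩ := hcomp.exists_mapClusterPt (f := atTop) (u := m)
    (tendsto_principal.2 (.of_forall fun n => subset_closure ⟨n, rfl⟩))
  refine ⟨μ, fun f hfC hfL => ?_⟩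
  obtain ⟨c, hc⟩ := hlim f hfC hfL
  obtain ⟨C, hC⟩ := hfC
  obtain ⟨L, hL⟩ := hfL
  let g : BoundedContinuousFunction E ℝ := ⟨⟨f, hL.continuous⟩, C, hC⟩
  have hg : Tendsto (fun ρ : ProbabilityMeasure E => ∫ x, g x ∂(ρ : Measure E)) (𝓝 μ)
      (𝓝 (∫ x, g x ∂(μ : Measure E))) :=
    (ProbabilityMeasure.tendsto_iff_forall_integral_tendsto.1 tendsto_id) g
  have h1 : MapClusterPt (∫ x, g x ∂(μ : Measure E)) atTop
      ((fun ρ : ProbabilityMeasure E => ∫ x, g x ∂(ρ : Measure E)) ∘ m) := hμ.tendsto_comp hg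
  have h2 : Tendsto ((fun ρ : ProbabilityMeasure E => ∫ x, g x ∂(ρ : Measure E)) ∘ m) atTop
      (𝓝 c) := by
    refine hc.congr fun n => ?_
    exact (integral_map (hY n).aemeasurable hL.continuous.measurable.aestronglyMeasurable).symm
  have h3 : (𝓝 (∫ x, g x ∂(μ : Measure E)) ⊓ 𝓝 c).NeBot := NeBot.mono h1 (inf_le_inf_left _ h2)
  rw [show ∫ x, f x ∂(μ : Measure E) = c from eq_of_nhds_neBot h3]
  exact hc

end Limit

/-! ### Decomposition and construction of the autoregressive process -/

section Autoregression

variable {r p q : ℕ} {P : Matrix (Fin r) (Fin r) ℝ} {B : Fin r → Matrix (Fin p) (Fin p) ℝ}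
  {S : Fin r → Matrix (Fin p) (Fin q) ℝ} {ν : Fin r → Measure (EuclideanSpace ℝ (Fin q))}
  {Ω : Type u} [MeasurableSpace Ω] {Pr : Measure Ω} {I : ℕ → Ω → Fin r}
  {ε : ℕ → Fin r → Ω → EuclideanSpace ℝ (Fin q)} {X : ℕ → Ω → EuclideanSpace ℝ (Fin p)}

theorem IsProcess.eq_orbit_add_pathProc (h : IsProcess P B S ν Pr I ε X) (n : ℕ) (ω : Ω) :
    X n ω = orbit (fun j D => Matrix.toEuclideanCLM (n := Fin p) (𝕜 := ℝ) (B j) * D)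
        (fun k => I k ω) 1 n (X 0 ω) +
      pathProc (fun j => Matrix.toEuclideanCLM (n := Fin p) (𝕜 := ℝ) (B j))
        (fun j => (Matrix.toEuclideanLin (S j)).toContinuousLinearMap)
        (fun k => I k ω) (fun k => ε k.1 k.2 ω) n :=
  SVAR.eq_orbit_add_pathProc (x := fun n => X n ω) (fun n => h.recursion n ω) n

theorem IsProcess.measurable_pathProc {E : Type*} [NormedAddCommGroup E] [NormedSpace ℝ E]
    [MeasurableSpace E] [BorelSpace E] [SecondCountableTopology E] {A : Fin r → E →L[ℝ] E}
    {T : Fin r → EuclideanSpace ℝ (Fin q) →L[ℝ] E} (h : IsProcess P B S ν Pr I ε X) (n : ℕ) :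
    Measurable fun ω => pathProc A T (fun k => I k ω) (fun k => ε k.1 k.2 ω) n :=
  (SVAR.measurable_pathProc n).comp ((measurable_pi_lambda _ h.chain.measurable).prodMk
    (measurable_pi_lambda _ fun k => h.measurable_noise k.1 k.2))

theorem IsProcess.measurable (h : IsProcess P B S ν Pr I ε X) (n : ℕ) : Measurable (X n) := by
  induction n with
  | zero => exact h.measurable_init
  | succ n ih =>
    have hm : Measurable fun w : Fin r × (EuclideanSpace ℝ (Fin p) ×
        (Fin r → EuclideanSpace ℝ (Fin q))) =>
        Matrix.toEuclideanLin (B w.1) w.2.1 + Matrix.toEuclideanLin (S w.1) (w.2.2 w.1) := by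
      refine measurable_from_prod_countable_right fun j => ?_
      have h1 : Measurable (Matrix.toEuclideanLin (B j)) :=
        (LinearMap.continuous_of_finiteDimensional _).measurable
      have h2 : Measurable (Matrix.toEuclideanLin (S j)) :=
        (LinearMap.continuous_of_finiteDimensional _).measurable
      exact (h1.comp measurable_fst).add
        (h2.comp ((measurable_pi_apply j).comp measurable_snd))
    have hp : Measurable fun ω => (I (n + 1) ω, (X n ω, fun j => ε (n + 1) j ω)) :=
      (h.chain.measurable _).prodMk
        (ih.prodMk (measurable_pi_lambda _ fun j => h.measurable_noise _ _))
    have hc := hm.comp hp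
    simp only [Function.comp_def, ← h.recursion n] at hc
    exact hc

/-- The recursively defined process. -/
noncomputable def stateProc (B : Fin r → Matrix (Fin p) (Fin p) ℝ)
    (S : Fin r → Matrix (Fin p) (Fin q) ℝ) (I : ℕ → Ω → Fin r)
    (ε : ℕ → Fin r → Ω → EuclideanSpace ℝ (Fin q)) : ℕ → Ω → EuclideanSpace ℝ (Fin p)
  | 0, _ => 0
  | n + 1, ω => Matrix.toEuclideanLin (B (I (n + 1) ω)) (stateProc B S I ε n ω) +
      Matrix.toEuclideanLin (S (I (n + 1) ω)) (ε (n + 1) (I (n + 1) ω) ω)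

/-- Every chain extends to a process on a product space. -/
theorem IsMarkovChain.isProcess [IsProbabilityMeasure Pr] [∀ i, IsProbabilityMeasure (ν i)]
    (hI : IsMarkovChain P Pr I) :
    IsProcess P B S ν (Pr.prod (Measure.infinitePi fun k : ℕ × Fin r => ν k.2))
      (fun n ω => I n ω.1) (fun n i ω => ω.2 (n, i))
      (stateProc B S (fun n ω => I n ω.1) (fun n i ω => ω.2 (n, i))) where
  chain :=
    { measurable := fun n => (hI.measurable n).comp measurable_fst
      transition := fun n s => by
        have h : ∀ m : ℕ, (Pr.prod (Measure.infinitePi fun k : ℕ × Fin r => ν k.2))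
            {ω | ∀ k ≤ m, I k ω.1 = s k} = Pr {ω | ∀ k ≤ m, I k ω = s k} := by
          intro m
          have : {ω : Ω × (ℕ × Fin r → EuclideanSpace ℝ (Fin q)) | ∀ k ≤ m, I k ω.1 = s k} =
              {ω | ∀ k ≤ m, I k ω = s k} ×ˢ Set.univ := by
            ext ω
            simp
          rw [this, Measure.prod_prod, measure_univ, mul_one]
        rw [h, h]
        exact hI.transition n s }
  measurable_noise := fun n i => by fun_prop
  law_noise := fun n i => by
    have h1 : (Pr.prod (Measure.infinitePi fun k : ℕ × Fin r => ν k.2)).map Prod.snd = _ :=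
      Measure.map_snd_prod
    rw [measure_univ, one_smul] at h1
    have h2 := (measurePreserving_eval_infinitePi (fun k : ℕ × Fin r => ν k.2) (n, i)).map_eq
    rw [← h1, Measure.map_map (measurable_pi_apply _) measurable_snd] at h2
    exact h2
  indep_noise := by
    have h1 : (Pr.prod (Measure.infinitePi fun k : ℕ × Fin r => ν k.2)).map Prod.snd = _ :=
      Measure.map_snd_prod
    rw [measure_univ, one_smul] at h1
    refine (iIndepFun_iff_map_fun_eq_infinitePi_map fun k => by fun_prop).2 (h1.trans ?_)
    congr 1
    funext k
    have h2 := (measurePreserving_eval_infinitePi (fun k : ℕ × Fin r => ν k.2) k).map_eq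
    rw [← h1, Measure.map_map (measurable_pi_apply _) measurable_snd] at h2
    exact h2.symm
  indep_chain_noise :=
    indepFun_prod (measurable_pi_lambda _ hI.measurable) measurable_id
  measurable_init := measurable_const
  recursion := fun n ω => rfl

end Autoregression

/-! ### Convergence in distribution for an arbitrary start -/

section Convergence

variable {r p q : ℕ} {P : Matrix (Fin r) (Fin r) ℝ} {B : Fin r → Matrix (Fin p) (Fin p) ℝ}
  {S : Fin r → Matrix (Fin p) (Fin q) ℝ} {ν : Fin r → Measure (EuclideanSpace ℝ (Fin q))}
  {Ω : Type u} [MeasurableSpace Ω] {Pr : Measure Ω} [IsProbabilityMeasure Pr] {I : ℕ → Ω → Fin r}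
  {ε : ℕ → Fin r → Ω → EuclideanSpace ℝ (Fin q)} {X : ℕ → Ω → EuclideanSpace ℝ (Fin p)}

theorem IsStandardized.integrable_rpow_norm {ρ : Measure (EuclideanSpace ℝ (Fin q))}
    [IsProbabilityMeasure ρ] (h : IsStandardized ρ) {E : Type*} [NormedAddCommGroup E]
    [NormedSpace ℝ E] (T : EuclideanSpace ℝ (Fin q) →L[ℝ] E) {s : ℝ} (hs : 0 ≤ s) (hs1 : s ≤ 1) :
    Integrable (fun e => ‖T e‖ ^ s) ρ := by
  have h1 : Integrable (fun e => 1 + ‖T e‖) ρ :=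
    (integrable_const _).add (T.integrable_comp (h.memLp.integrable (by norm_num))).norm
  refine h1.mono' (T.continuous.norm.rpow_const fun _ => .inr hs).aestronglyMeasurable
    (.of_forall fun e => ?_)
  rw [Real.norm_of_nonneg (by positivity)]
  rcases le_total ‖T e‖ 1 with h2 | h2
  · exact (Real.rpow_le_one (norm_nonneg _) h2 hs).trans (by linarith [norm_nonneg (T e)])
  · exact (Real.rpow_le_rpow_of_exponent_le h2 hs1).trans (by rw [Real.rpow_one]; linarith)

theorem isBddMeas_of_lipschitz {E : Type*} [NormedAddCommGroup E] [MeasurableSpace E]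
    [BorelSpace E] {f : E → ℝ} {C : ℝ} (hC : ∀ x y, dist (f x) (f y) ≤ C) (hf : Continuous f) :
    IsBddMeas (|f 0| + C) fun _ : Fin r => f where
  measurable _ := hf.measurable
  abs_le _ x := by
    have h1 := hC x 0
    rw [Real.dist_eq] at h1
    have h2 := abs_sub_abs_le_abs_sub (f x) (f 0)
    linarith

theorem IsProcess.tendsto_integral_pathProc {E : Type*} [NormedAddCommGroup E] [NormedSpace ℝ E]
    [MeasurableSpace E] [BorelSpace E] [SecondCountableTopology E] {A : Fin r → E →L[ℝ] E}
    {T : Fin r → EuclideanSpace ℝ (Fin q) →L[ℝ] E} [∀ i, IsProbabilityMeasure (ν i)]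
    (hP : P ∈ Matrix.rowStochastic ℝ (Fin r)) (h : IsProcess P B S ν Pr I ε X) {K c : ℝ}
    {f : E → ℝ} (hf : IsBddMeas K fun _ : Fin r => f)
    (hc : ∀ i, Tendsto (fun n => ((transOp P A T ν)^[n] fun _ => f) i 0) atTop (𝓝 c)) :
    Tendsto (fun n => ∫ ω, f (pathProc A T (fun k => I k ω) (fun k => ε k.1 k.2 ω) n) ∂Pr) atTop
      (𝓝 c) := by
  refine (h.chain.tendsto_integral_init (fun n i =>
    (hf.transOp_iterate (A := A) (S := T) (ν := ν) hP n).abs_le i 0) hc).congr fun n => ?_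
  exact (integral_pathProc hP h.chain h.measurable_noise h.law_noise h.indep_noise
    h.indep_chain_noise hf n).symm

/-- If the process started at `0` converges in law, then so does every process with the same
regimes and noise. -/
theorem IsProcess.tendstoInDistribution (hP : P ∈ Matrix.rowStochastic ℝ (Fin r))
    (h : IsProcess P B S ν Pr I ε X) {s : ℝ} (hs : 0 < s) {a : ℕ → ℝ} (ha : Summable a)
    (hmom : ∀ n i, ((avg P fun j D => Matrix.toEuclideanCLM (n := Fin p) (𝕜 := ℝ) (B j) * D)^[n]
      fun _ D => ‖D‖ ^ s) i 1 ≤ a n)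
    {μ : ProbabilityMeasure (EuclideanSpace ℝ (Fin p))}
    (hμ : ∀ f : EuclideanSpace ℝ (Fin p) → ℝ, (∃ C : ℝ, ∀ x y, dist (f x) (f y) ≤ C) →
      (∃ L, LipschitzWith L f) →
      Tendsto (fun n => ∫ ω, f (pathProc
        (fun j => Matrix.toEuclideanCLM (n := Fin p) (𝕜 := ℝ) (B j))
        (fun j => (Matrix.toEuclideanLin (S j)).toContinuousLinearMap)
        (fun k => I k ω) (fun k => ε k.1 k.2 ω) n) ∂Pr) atTop
        (𝓝 (∫ x, f x ∂(μ : Measure (EuclideanSpace ℝ (Fin p)))))) :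
    TendstoInDistribution X atTop id (fun _ => Pr)
      (μ : Measure (EuclideanSpace ℝ (Fin p))) := by
  set Y : ℕ → Ω → EuclideanSpace ℝ (Fin p) := fun n ω => pathProc
    (fun j => Matrix.toEuclideanCLM (n := Fin p) (𝕜 := ℝ) (B j))
    (fun j => (Matrix.toEuclideanLin (S j)).toContinuousLinearMap)
    (fun k => I k ω) (fun k => ε k.1 k.2 ω) n with hY
  have hYm : ∀ n, Measurable (Y n) := h.measurable_pathProc
  have hYd : TendstoInDistribution Y atTop id (fun _ => Pr)
      (μ : Measure (EuclideanSpace ℝ (Fin p))) := by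
    refine ⟨fun n => (hYm n).aemeasurable, aemeasurable_id, ?_⟩
    refine tendsto_iff_forall_lipschitz_integral_tendsto.2 ?_
    intro f hC hL
    have hfm : Measurable f := hL.choose_spec.continuous.measurable
    simp only [ProbabilityMeasure.coe_mk, Measure.map_id]
    refine (hμ f hC hL).congr fun n => ?_
    exact (integral_map (hYm n).aemeasurable hfm.aestronglyMeasurable).symm
  -- Slutsky: `X n - Y n` is the product of the coefficients applied to `X 0`. It tends to zero
  -- almost surely whatever the law of `X 0` and its dependence on the regimes and noise.
  refine tendstoInDistribution_of_tendstoInMeasure_sub X id hYd ?_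
    fun n => (h.measurable n).aemeasurable
  refine tendstoInMeasure_of_tendsto_ae
    (fun n => ((h.measurable n).sub (hYm n)).aestronglyMeasurable) ?_
  filter_upwards [h.chain.ae_tendsto_orbit hP hs ha hmom] with ω hω
  have h1 := ((ContinuousLinearMap.apply ℝ (EuclideanSpace ℝ (Fin p)) (X 0 ω)).continuous.tendsto
    0).comp hω
  simp only [map_zero] at h1
  refine h1.congr fun n => ?_
  simp only [Function.comp, ContinuousLinearMap.apply_apply, Pi.sub_apply, hY]
  rw [h.eq_orbit_add_pathProc n ω, add_sub_cancel_right]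

end Convergence

end SVAR

/-! ### Existence and uniqueness of the limit law -/

theorem theorem1 {r p q : ℕ}
    -- the transition matrix of the regime chain
    (P : Matrix (Fin r) (Fin r) ℝ) (hP : P ∈ Matrix.rowStochastic ℝ (Fin r))
    (hirr : P.IsIrreducible) (haper : SVAR.IsAperiodic P)
    -- the coefficients and the laws of the noise in the regimes
    (B : Fin r → Matrix (Fin p) (Fin p) ℝ) (S : Fin r → Matrix (Fin p) (Fin q) ℝ)
    (ν : Fin r → Measure (EuclideanSpace ℝ (Fin q))) [∀ i, IsProbabilityMeasure (ν i)]
    (hν : ∀ i, SVAR.IsStandardized (ν i))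
    -- the largest Lyapunov exponent exists and is negative almost surely, for a regime chain `J`
    -- (for example the stationary one)
    {Ω₀ : Type u} [MeasurableSpace Ω₀] (Pr₀ : Measure Ω₀) [IsProbabilityMeasure Pr₀]
    (J : ℕ → Ω₀ → Fin r) (hJ : SVAR.IsMarkovChain P Pr₀ J) (lam : Ω₀ → EReal)
    (hlam : ∀ᵐ ω ∂Pr₀,
      Tendsto (fun n : ℕ => SVAR.logGrowth B J n ω) atTop (𝓝 (lam ω)) ∧ lam ω < 0) :
    -- one and the same law is the limit in distribution of every such process, whatever its
    -- initial value and its initial regime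
    ∃! μ : ProbabilityMeasure (EuclideanSpace ℝ (Fin p)),
      ∀ (Ω : Type u) [MeasurableSpace Ω] (Pr : Measure Ω) [IsProbabilityMeasure Pr]
        (I : ℕ → Ω → Fin r) (ε : ℕ → Fin r → Ω → EuclideanSpace ℝ (Fin q))
        (X : ℕ → Ω → EuclideanSpace ℝ (Fin p)),
        SVAR.IsProcess P B S ν Pr I ε X →
          TendstoInDistribution X atTop id (fun _ => Pr)
            (μ : Measure (EuclideanSpace ℝ (Fin p))) := by
  obtain ⟨s, hs, hs1, a, ha, hasum, hmom, hmomv⟩ :=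
    SVAR.exists_summable_moment hP hirr haper B hJ hlam
  set A := fun j => Matrix.toEuclideanCLM (n := Fin p) (𝕜 := ℝ) (B j) with hA
  set T := fun j => (Matrix.toEuclideanLin (S j)).toContinuousLinearMap with hT
  have hint : ∀ j, Integrable (fun e => ‖T j e‖ ^ s) (ν j) := fun j =>
    (hν j).integrable_rpow_norm (T j) hs.le hs1
  obtain ⟨D, hD0, hD⟩ : ∃ D, 0 ≤ D ∧ ∀ j, ∫ e, ‖T j e‖ ^ s ∂ν j ≤ D := by
    have h0 : ∀ j, 0 ≤ ∫ e, ‖T j e‖ ^ s ∂ν j := fun j =>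
      integral_nonneg fun e => Real.rpow_nonneg (norm_nonneg _) _
    exact ⟨∑ j, ∫ e, ‖T j e‖ ^ s ∂ν j, Finset.sum_nonneg fun j _ => h0 j, fun j =>
      Finset.single_le_sum (f := fun j => ∫ e, ‖T j e‖ ^ s ∂ν j) (fun j _ => h0 j)
        (Finset.mem_univ j)⟩
  have hlim : ∀ f : EuclideanSpace ℝ (Fin p) → ℝ, (∃ C : ℝ, ∀ x y, dist (f x) (f y) ≤ C) →
      (∃ L, LipschitzWith L f) → ∃ K, SVAR.IsBddMeas K (fun _ : Fin r => f) ∧ ∃ c, ∀ i,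
        Tendsto (fun n => ((SVAR.transOp P A T ν)^[n] fun _ => f) i 0) atTop (𝓝 c) := by
    rintro f ⟨C, hC⟩ ⟨L, hL⟩
    obtain ⟨M, hM, hfM⟩ := SVAR.exists_holder_of_lipschitz hC hL hs hs1
    have hf := SVAR.isBddMeas_of_lipschitz (r := r) hC hL.continuous
    exact ⟨_, hf, SVAR.exists_tendsto_transOp_iterate hP hirr haper ha hasum hmomv hint hD hM hf
      hfM⟩
  -- This process serves twice: its limit law is the candidate `μ`, and its existence keeps the
  -- universal statement from being vacuous, which gives uniqueness.
  have hproc := hJ.isProcess (B := B) (S := S) (ν := ν)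
  obtain ⟨μ, hμ⟩ := SVAR.exists_limit_of_tight
    (Pr := Pr₀.prod (Measure.infinitePi fun k : ℕ × Fin r => ν k.2))
    (Y := fun n ω => SVAR.pathProc A T (fun k => J k ω.1) (fun k => ω.2 (k.1, k.2)) n)
    hproc.measurable_pathProc
    (SVAR.isTightMeasureSet_of_moment_le hproc.measurable_pathProc hs
      (M := 1 * D * ∑' k, a k) fun n R hR => by
        have hf : SVAR.IsBddMeas R
            (fun _ : Fin r => fun x : EuclideanSpace ℝ (Fin p) => min (‖x‖ ^ s) R) :=
          ⟨fun _ => (measurable_norm.pow_const s).min measurable_const, fun _ x => by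
            rw [abs_of_nonneg (by positivity)]
            exact min_le_right _ _⟩
        have h1 := SVAR.integral_pathProc (A := A) (S := T) hP hproc.chain hproc.measurable_noise
          hproc.law_noise hproc.indep_noise hproc.indep_chain_noise hf n
        refine h1.trans_le ?_
        have h2 := norm_integral_le_of_norm_le_const
          (μ := Pr₀.prod (Measure.infinitePi fun k : ℕ × Fin r => ν k.2))
          (f := fun ω => ((SVAR.transOp P A T ν)^[n]
            fun _ x => min (‖x‖ ^ s) R) (J 0 ω.1) 0)
          (.of_forall fun ω => SVAR.abs_transOp_iterate_zero_le hP ha hasum hmomv hint hD hD0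
            zero_le_one hf (SVAR.abs_min_rpow_norm_sub_le hs.le hs1 R)
            (by simp [Real.zero_rpow hs.ne', hR]) n (J 0 ω.1))
        rw [probReal_univ, mul_one] at h2
        exact (le_abs_self _).trans h2)
    (fun f hC hL => by
      obtain ⟨K, hf, c, hc⟩ := hlim f hC hL
      exact ⟨c, hproc.tendsto_integral_pathProc hP hf hc⟩)
  refine ⟨μ, fun Ω _ Pr _ I ε X hX => ?_, fun μ' hμ' => ?_⟩
  · refine hX.tendstoInDistribution hP hs hasum hmom fun f hC hL => ?_
    obtain ⟨K, hf, c, hc⟩ := hlim f hC hL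
    -- The constant `c` depends on neither the chain nor its initial law, so the test integrals of
    -- both processes have the same limit.
    rw [tendsto_nhds_unique (hμ f hC hL) (hproc.tendsto_integral_pathProc hP hf hc)]
    exact hX.tendsto_integral_pathProc hP hf hc
  · have h1 := hproc.tendstoInDistribution hP hs hasum hmom hμ
    have h2 := tendstoInDistribution_unique _ (hμ' _ _ _ _ _ hproc) h1
    rw [Measure.map_id, Measure.map_id] at h2
    exact Subtype.ext h2
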